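/- **Setting.** There are $U$ users with preference vectors $\theta_u\in\mathbb R^d$, $\|\theta_u\|_2\le 1$, partitioned into clusters $\mathcal V(1),\dots,\mathcal V(J)$ such that $\theta_u=\theta_v$ if and only if $u,v$ lie in the same cluster; $j_u$ is the cluster index of $u$, and $\|\theta_u-\theta_v\|_2\ge\gamma>0$ for users in different clusters. User $u$ has $N_u$ samples $(a_u^i,r_u^i)$; for a set $\mathcal S$ of users put $N_{\mathcal S}=\sum_{v\in\mathcal S}N_v$. *Actions.* Let $\rho$ be a probability distribution on the closed unit ball of $\mathbb R^d$ such that $\mathbb E_{a\sim\rho}[aa^\top]$ has minimum eigenvalue $\lambda_a>0$ and, for every unit vector $v$, $Z=(v^\top a)^2$ satisfies $\Pr(Z-\mathbb EZ\ge t)\le e^{-t^2/(2\sigma^2)}$ and $\Pr(Z-\mathbb EZ\le -t)\le e^{-t^2/(2\sigma^2)}$ for all $t\ge0$, where $\sigma>0$. Each $a_u^i$ is selected, by an arbitrary rule, from a candidate set of at most $S$ vectors; the candidate vectors of each user are i.i.d. with law $\rho$. Put $\tilde\lambda_a=\int_0^{\lambda_a}\bigl(1-e^{-(\lambda_a-x)^2/(2\sigma^2)}\bigr)^S\,dx$.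 *Rewards.* The rewards are drawn one after the other in some order; given the action $a_u^i$ and everything observed before, $r_u^i$ has mean $\langle\theta_u,a_u^i\rangle$ and is $1$-sub-Gaussian. **Algorithm Off-CLUB** (parameters $\alpha,\lambda,\delta$; $\tilde\lambda_a$ known). Put $\beta(n)=\sqrt{d\log(1+\frac{n}{\lambda d})+2\log\frac{2U}{\delta}}+\sqrt\lambda$. For each user let $M_u=\lambda I+\sum_i a_u^i(a_u^i)^\top$, $\hat\theta_u=M_u^{-1}\sum_i r_u^ia_u^i$ and $\mathrm{CI}_u=\beta(N_u)/\sqrt{\tilde\lambda_aN_u/2}$. Start from the complete graph on the users and remove every edge $(u,v)$ with $\|\hat\theta_u-\hat\theta_v\|_2>\alpha(\mathrm{CI}_u+\mathrm{CI}_v)$. For test user $u_{\rm test}$, pool the samples of $u_{\rm test}$ and of its remaining neighbours; let $\tilde N$ be their number, $\tilde M=\lambda I+\sum aa^\top$ and $\tilde\theta=\tilde M^{-1}\sum ra$ (sums over the pooled samples). Given an action set $\mathcal A$ in the closed unit ball, output a maximizer $a_{\rm test}$ over $a\in\mathcal A$ of $\tilde\theta^\top a-\beta(\tilde N)\sqrt{a^\top\tilde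 M^{-1}a}$. Its suboptimality is $\mathrm{SubOpt}=\sup_{a\in\mathcal A}\langle\theta_{u_{\rm test}},a\rangle-\langle\theta_{u_{\rm test}},a_{\rm test}\rangle$. **Theorem (upper bound for Off-CLUB).** Let $\delta\in(0,\tfrac12)$, $\alpha=1$, $\lambda>0$, and put $T_\gamma=\frac{512d}{\gamma^2\tilde\lambda_a}\log\frac{2U}{\delta}$. Assume that the dataset is completely $\delta$-sufficient, that is, for every user $u$, $$N_u\ge\max\Bigl\{\tfrac{16}{\tilde\lambda_a^2}\log\tfrac{8dU}{\tilde\lambda_a^2\delta},\ T_\gamma\Bigr\},$$ and that the parameters satisfy $\lambda\le d\log\bigl(1+\frac{N_u}{\lambda d}\bigr)+2\log\frac{2U}{\delta}$ for every $u$, and $\delta\le\frac{2U}{1+T_\gamma/(\lambda d)}$. Then with probability at least $1-2\delta$ the following hold simultaneously. All users are clustered correctly: for every user $u$, its connected component in the final graph, and also the set consisting of $u$ and its neighbours, equals $\mathcal V(j_u)$. Moreover, for every test user $u_{\rm test}$ and every action set $\mathcal A$ in the closed unit ball, with $N=N_{\mathcal V(j_{u_{\rm test}})}$, $$\mathrm{SubOpt}\le\frac{2\beta(N)}{\sqrt{\lambda+\tilde\lambda_aN/2}}\qquad\text{and}\qquad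 \mathrm{SubOpt}\le 8\sqrt{\frac{d}{\tilde\lambda_aN}}\ \sqrt{\log\Bigl(1+\frac{N}{\lambda d}\Bigr)+\log\frac{2U}{\delta}},$$ so that $\mathrm{SubOpt}=\tilde O\bigl(\sqrt{d/(\tilde\lambda_aN)}\bigr)$. -/

import Mathlib

open MeasureTheory ProbabilityTheory
open scoped RealInnerProductSpace Matrix

noncomputable section

namespace OffClusBand

/-- `ℝ^d` with the Euclidean inner product and norm. -/
abbrev Vec (d : ℕ) := EuclideanSpace ℝ (Fin d)

/-! ### Offline datasets and the Off-CLUB algorithm -/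

/-- An offline dataset for `U` users: `N u` samples `(a_u^i, r_u^i)` for each user `u`. -/
structure Dataset (U d : ℕ) where
  N : Fin U → ℕ
  act : (u : Fin U) → Fin (N u) → Vec d
  rew : (u : Fin U) → Fin (N u) → ℝ

/-- Total number of samples `N_V = ∑_{v ∈ V} N_v` of a set of users. -/
def sampleCount {U : ℕ} (N : Fin U → ℕ) (V : Finset (Fin U)) : ℕ := ∑ v ∈ V, N v

/-- `√(d log(1 + n/(λ d)) + 2 log(2U/δ)) + √λ`. -/
def confRadius (U d : ℕ) (lam δ : ℝ) (n : ℕ) : ℝ :=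
  √(d * Real.log (1 + n / (lam * d)) + 2 * Real.log (2 * U / δ)) + √lam

namespace Dataset

variable {U d : ℕ} (D : Dataset U d)

/-- Regularized Gram matrix `λ I + ∑ a aᵀ` over all samples of the users in `V`. -/
def gram (lam : ℝ) (V : Finset (Fin U)) : Matrix (Fin d) (Fin d) ℝ :=
  lam • (1 : Matrix (Fin d) (Fin d) ℝ)
    + ∑ v ∈ V, ∑ i : Fin (D.N v), Matrix.vecMulVec (D.act v i).ofLp (D.act v i).ofLp

/-- `∑ r a` over all samples of the users in `V`. -/
def moment (V : Finset (Fin U)) : Fin d → ℝ :=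
  ∑ v ∈ V, ∑ i : Fin (D.N v), D.rew v i • (D.act v i).ofLp

/-- Ridge regression estimate from the pooled samples of the users in `V`. -/
def ridge (lam : ℝ) (V : Finset (Fin U)) : Vec d :=
  WithLp.toLp 2 ((D.gram lam V)⁻¹ *ᵥ D.moment V)

/-- Confidence width `CI_u`; `lt` is the smoothed regularity parameter given to the algorithm. -/
def CI (lam lt δ : ℝ) (u : Fin U) : ℝ :=
  confRadius U d lam δ (D.N u) / √(lt * D.N u / 2)

/-- The graph left by the Cluster Phase: start from the complete graph and remove the edge `(u, v)`
if `‖θ̂_u - θ̂_v‖ > α (CI_u + CI_v)`. -/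
def graph (α lam lt δ : ℝ) : SimpleGraph (Fin U) where
  Adj u v := u ≠ v ∧
    ¬ (‖D.ridge lam {u} - D.ridge lam {v}‖ > α * (D.CI lam lt δ u + D.CI lam lt δ v))
  symm := ⟨fun u v h => ⟨h.1.symm, by
    rw [norm_sub_rev, add_comm (D.CI lam lt δ v)]; exact h.2⟩⟩
  loopless := ⟨fun _ h => h.1 rfl⟩

open Classical in
/-- User `u` together with its neighbours in the final graph: the users whose data are pooled
for `u`. -/
def pool (α lam lt δ : ℝ) (u : Fin U) : Finset (Fin U) :=
  Finset.univ.filter fun v => v = u ∨ (D.graph α lam lt δ).Adj u v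

/-- The pessimistic value `θ̃_uᵀ a - β ‖a‖_{M̃_u⁻¹}` computed from the pooled data of `u`. -/
def pessimisticValue (α lam lt δ : ℝ) (u : Fin U) (a : Vec d) : ℝ :=
  ⟪D.ridge lam (D.pool α lam lt δ u), a⟫
    - confRadius U d lam δ (sampleCount D.N (D.pool α lam lt δ u))
      * √(a.ofLp ⬝ᵥ ((D.gram lam (D.pool α lam lt δ u))⁻¹ *ᵥ a.ofLp))

/-- `a` is an output of Off-CLUB for test user `u` and action set `A`: a maximizer over `A` of the
pessimistic value (ties broken arbitrarily). -/
def IsOffCLUBAction (α lam lt δ : ℝ) (u : Fin U) (A : Set (Vec d)) (a : Vec d) : Prop :=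
  a ∈ A ∧ ∀ b ∈ A, D.pessimisticValue α lam lt δ u b ≤ D.pessimisticValue α lam lt δ u a

/-- All users are clustered correctly, where `cl u` is the true cluster index of user `u`: the
connected component of every user in the final graph, and also the set of users pooled for it, is
exactly its true cluster. -/
def ClustersCorrectly {J : ℕ} (cl : Fin U → Fin J) (α lam lt δ : ℝ) : Prop :=
  ∀ u, ((D.graph α lam lt δ).connectedComponentMk u).supp = {v | cl v = cl u} ∧
    (D.pool α lam lt δ u : Set (Fin U)) = {v | cl v = cl u}

end Dataset

/-- The true cluster `V(j_u)` of user `u`. -/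
def trueCluster {U J : ℕ} (cl : Fin U → Fin J) (u : Fin U) : Finset (Fin U) :=
  Finset.univ.filter fun v => cl v = cl u

/-- Suboptimality gap of the action `a` for preference vector `θ` and action set `A`; the supremum
is `⟨θ, a*⟩` whenever an optimal action `a*` exists. -/
def subOpt {d : ℕ} (θ : Vec d) (A : Set (Vec d)) (a : Vec d) : ℝ :=
  sSup ((fun b => ⟪θ, b⟫) '' A) - ⟪θ, a⟫

/-! ### Stochastic assumptions -/

/-- `E_{a ∼ ρ}[a aᵀ]`. -/
def secondMoment {d : ℕ} (ρ : Measure (Vec d)) : Matrix (Fin d) (Fin d) ℝ :=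
  Matrix.of fun i j => ∫ a, a i * a j ∂ρ

/-- `X` has sub-Gaussian tails (around its mean) with variance parameter `σ²`. -/
def HasSubgaussianTails {α : Type*} [MeasurableSpace α] (X : α → ℝ) (σ : ℝ) (μ : Measure α) :
    Prop :=
  ∀ t : ℝ, 0 ≤ t →
    μ.real {x | X x - ∫ y, X y ∂μ ≥ t} ≤ Real.exp (-t ^ 2 / (2 * σ ^ 2)) ∧
    μ.real {x | X x - ∫ y, X y ∂μ ≤ -t} ≤ Real.exp (-t ^ 2 / (2 * σ ^ 2))

/-- Regularity of the action distribution `ρ`: it lives on the closed unit ball, the minimum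
eigenvalue of `E[a aᵀ]` is `lamA > 0`, and `(vᵀ a)²` has sub-Gaussian tails with parameter `σ²`
for every unit vector `v`. -/
structure ActionRegular {d : ℕ} (ρ : Measure (Vec d)) (lamA σ : ℝ) : Prop where
  isProb : IsProbabilityMeasure ρ
  norm_le : ∀ᵐ a ∂ρ, ‖a‖ ≤ 1
  minEigenvalue : IsLeast (spectrum ℝ (secondMoment ρ)) lamA
  lamA_pos : 0 < lamA
  sigma_pos : 0 < σ
  tails : ∀ v : Vec d, ‖v‖ = 1 → HasSubgaussianTails (fun a : Vec d => ⟪v, a⟫ ^ 2) σ ρ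

/-- The smoothed regularity parameter `∫_0^{λ_a} (1 - exp(-(λ_a - x)²/(2σ²)))^S dx`. -/
def smoothedReg (lamA σ : ℝ) (S : ℕ) : ℝ :=
  ∫ x in (0 : ℝ)..lamA, (1 - Real.exp (-(lamA - x) ^ 2 / (2 * σ ^ 2))) ^ S

/-- A random offline dataset with preference vectors `θ`, on a probability space `(Ω, P)`.

*Actions.* The action of sample `(u, i)` is an element of a candidate set of at most `S` vectors;
the candidate vectors of each user are independent with law `ρ`. The selection rule is arbitrary
(it may use past data).

*Rewards.* The rewards are drawn one after the other, sample `(u, i)` at time `time ⟨u, i⟩`, and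
`ℱ n` is the information present just before the draw at time `n`, including the action of that
sample. Given this information, the reward has mean `⟨θ_u, a_u^i⟩` and is 1-sub-Gaussian (the bound
on the conditional moment generating function for all `s` contains the statement on the mean).
Rewards that are conditionally independent given all actions are the special case in which all
actions are already `ℱ 0`-measurable; actions of an adaptive logging policy are also covered. -/
structure OfflineData {Ω : Type*} [mΩ : MeasurableSpace Ω] (P : Measure Ω) {U d : ℕ}
    (θ : Fin U → Vec d) (ρ : Measure (Vec d)) (S : ℕ) where
  N : Fin U → ℕ
  act : (u : Fin U) → Fin (N u) → Ω → Vec d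
  rew : (u : Fin U) → Fin (N u) → Ω → ℝ
  numCand : (u : Fin U) → Fin (N u) → ℕ
  numCand_le : ∀ u i, numCand u i ≤ S
  cand : (u : Fin U) → (i : Fin (N u)) → Fin (numCand u i) → Ω → Vec d
  cand_measurable : ∀ u i j, Measurable (cand u i j)
  cand_law : ∀ u i j, P.map (cand u i j) = ρ
  cand_indep : ∀ u, iIndepFun
    (fun (p : (i : Fin (N u)) × Fin (numCand u i)) => cand u p.1 p.2) P
  act_mem : ∀ u i, ∀ᵐ ω ∂P, ∃ j, act u i ω = cand u i j ω
  ℱ : Filtration ℕ mΩ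
  time : ((u : Fin U) × Fin (N u)) → ℕ
  time_injective : Function.Injective time
  act_measurable : ∀ u i, Measurable[ℱ (time ⟨u, i⟩)] (act u i)
  rew_measurable : ∀ u i, Measurable[ℱ (time ⟨u, i⟩ + 1)] (rew u i)
  noise_integrable : ∀ u i (s : ℝ),
    Integrable (fun ω => Real.exp (s * (rew u i ω - ⟪θ u, act u i ω⟫))) P
  noise_subgaussian : ∀ u i (s : ℝ),
    P[fun ω => Real.exp (s * (rew u i ω - ⟪θ u, act u i ω⟫)) | ℱ (time ⟨u, i⟩)]
      ≤ᵐ[P] fun _ => Real.exp (s ^ 2 / 2)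

/-- The dataset observed at the outcome `ω`. -/
def OfflineData.dataset {Ω : Type*} [MeasurableSpace Ω] {P : Measure Ω} {U d : ℕ}
    {θ : Fin U → Vec d} {ρ : Measure (Vec d)} {S : ℕ} (X : OfflineData P θ ρ S) (ω : Ω) :
    Dataset U d where
  N := X.N
  act u i := X.act u i ω
  rew u i := X.rew u i ω

/-- The sample size that separates clusters at distance `γ`:
`(512 d / (γ² λ̃)) log(2U/δ)`. -/
def gapThreshold (U d : ℕ) (lt γ δ : ℝ) : ℝ :=
  512 * d / (γ ^ 2 * lt) * Real.log (2 * U / δ)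

/-- The dataset of every user is `δ`-sufficient. -/
def CompletelySufficient {U : ℕ} (d : ℕ) (N : Fin U → ℕ) (lt γ δ : ℝ) : Prop :=
  ∀ u, max (16 / lt ^ 2 * Real.log (8 * d * U / (lt ^ 2 * δ))) (gapThreshold U d lt γ δ)
    ≤ (N u : ℝ)

end OffClusBand

end

/-!
Write `λ̃` for the smoothed regularity parameter and `‖x‖_M = √(xᵀ M x)`.

*Noise.* Averaged over a Gaussian prior on `x`, the exponentials `exp (⟨x, s⟩ - xᵀ G x / 2)` of the
noise vector `s` and the Gram matrix `G` give `λ^(d/2) det(M)^(-1/2) exp (‖s‖²_{M⁻¹} / 2)` with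
`M = λ I + G`. Sub-Gaussian rewards make the average at most `1` in expectation, so Markov's
inequality bounds `‖s‖_{M⁻¹}` by the determinant, and AM-GM bounds the determinant by the trace.

*Excitation.* However the action is selected, `(vᵀ a)²` is at least its minimum over the candidates,
whose mean is at least `λ̃`. A Chernoff bound for these independent minima and a net of the sphere
of mesh `√λ̃ / 24` give `∑ a aᵀ ≥ (λ̃ N_u / 2) I` for every user.

*Clustering.* Together these put every single-user estimate within `CI_u < γ / 4` of its target, so
exactly the edges between different clusters are removed.

*Pessimism.* On the pooled data, the pessimistic value of `a` is a lower bound for `⟨θ, a⟩`, and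
that of any `b` is at least `⟨θ, b⟩ - 2 β ‖b‖_{M⁻¹}`; maximality of the pessimistic value of the
output and `M ≥ (λ + λ̃ N / 2) I` finish the proof.
-/

namespace OffClusBand

section WeightedNorm

variable {n : Type*} [Fintype n] {A : Matrix n n ℝ}

/-- The seminorm `‖x‖_A = √(xᵀ A x)` of a positive semidefinite matrix `A`. Confidence ellipsoids
are balls for `A = M`, and the pessimism penalty is the dual seminorm, `A = M⁻¹`. -/
noncomputable def weightedNorm (A : Matrix n n ℝ) (x : n → ℝ) : ℝ :=
  √(x ⬝ᵥ (A *ᵥ x))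

theorem weightedNorm_nonneg (A : Matrix n n ℝ) (x : n → ℝ) : 0 ≤ weightedNorm A x :=
  Real.sqrt_nonneg _

theorem sq_weightedNorm (hA : A.PosSemidef) (x : n → ℝ) :
    weightedNorm A x ^ 2 = x ⬝ᵥ (A *ᵥ x) :=
  Real.sq_sqrt (by simpa using hA.dotProduct_mulVec_nonneg x)

theorem weightedNorm_smul (A : Matrix n n ℝ) (c : ℝ) (x : n → ℝ) :
    weightedNorm A (c • x) = |c| * weightedNorm A x := by
  rw [weightedNorm, Matrix.mulVec_smul, dotProduct_smul, smul_dotProduct, smul_smul, ← sq,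
    smul_eq_mul, Real.sqrt_mul (sq_nonneg c), Real.sqrt_sq_eq_abs, weightedNorm]

theorem exists_eq_transpose_mul_self (hA : A.PosSemidef) : ∃ C : Matrix n n ℝ, A = Cᵀ * C := by
  classical
  open scoped MatrixOrder in
  obtain ⟨C, rfl⟩ := CStarAlgebra.nonneg_iff_eq_star_mul_self.mp hA.nonneg
  exact ⟨C, by rw [Matrix.star_eq_conjTranspose, Matrix.conjTranspose_eq_transpose_of_trivial]⟩

theorem dotProduct_transpose_mul_self_mulVec (C : Matrix n n ℝ) (x y : n → ℝ) :
    x ⬝ᵥ ((Cᵀ * C) *ᵥ y) = (C *ᵥ x) ⬝ᵥ (C *ᵥ y) := by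
  rw [← Matrix.mulVec_mulVec, Matrix.dotProduct_mulVec, Matrix.vecMul_transpose]

theorem weightedNorm_transpose_mul_self (C : Matrix n n ℝ) (x : n → ℝ) :
    weightedNorm (Cᵀ * C) x = ‖WithLp.toLp 2 (C *ᵥ x)‖ := by
  rw [weightedNorm, dotProduct_transpose_mul_self_mulVec, EuclideanSpace.norm_eq]
  simp [dotProduct, sq]

theorem weightedNorm_sub_le (hA : A.PosSemidef) (x y : n → ℝ) :
    weightedNorm A (x - y) ≤ weightedNorm A x + weightedNorm A y := by
  obtain ⟨C, rfl⟩ := exists_eq_transpose_mul_self hA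
  simp only [weightedNorm_transpose_mul_self, Matrix.mulVec_sub, WithLp.toLp_sub]
  exact norm_sub_le _ _

theorem dotProduct_mulVec_le_weightedNorm_mul (hA : A.PosSemidef) (x y : n → ℝ) :
    x ⬝ᵥ (A *ᵥ y) ≤ weightedNorm A x * weightedNorm A y := by
  obtain ⟨C, rfl⟩ := exists_eq_transpose_mul_self hA
  simp only [weightedNorm_transpose_mul_self, dotProduct_transpose_mul_self_mulVec]
  simpa [PiLp.inner_apply, dotProduct, mul_comm] using
    real_inner_le_norm (WithLp.toLp 2 (C *ᵥ x)) (WithLp.toLp 2 (C *ᵥ y))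

variable [DecidableEq n]

theorem mulVec_inv_mulVec (hA : A.PosDef) (x : n → ℝ) : A *ᵥ (A⁻¹ *ᵥ x) = x := by
  rw [Matrix.mulVec_mulVec, Matrix.mul_nonsing_inv _ hA.det_pos.ne'.isUnit, Matrix.one_mulVec]

theorem inv_mulVec_mulVec (hA : A.PosDef) (x : n → ℝ) : A⁻¹ *ᵥ (A *ᵥ x) = x := by
  rw [Matrix.mulVec_mulVec, Matrix.nonsing_inv_mul _ hA.det_pos.ne'.isUnit, Matrix.one_mulVec]

theorem weightedNorm_inv_mulVec (hA : A.PosDef) (x : n → ℝ) :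
    weightedNorm A (A⁻¹ *ᵥ x) = weightedNorm A⁻¹ x := by
  rw [weightedNorm, mulVec_inv_mulVec hA, dotProduct_comm, weightedNorm]

theorem dotProduct_le_weightedNorm_mul_inv (hA : A.PosDef) (x y : n → ℝ) :
    x ⬝ᵥ y ≤ weightedNorm A x * weightedNorm A⁻¹ y := by
  have h := dotProduct_mulVec_le_weightedNorm_mul hA.posSemidef x (A⁻¹ *ᵥ y)
  rwa [mulVec_inv_mulVec hA, weightedNorm_inv_mulVec hA] at h

theorem weightedNorm_inv_le (hA : A.PosDef) {m : ℝ} (hm : 0 < m)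
    (h : ∀ x : EuclideanSpace ℝ n, m * ‖x‖ ≤ weightedNorm A x.ofLp) (b : EuclideanSpace ℝ n) :
    weightedNorm A⁻¹ b.ofLp ≤ ‖b‖ / m := by
  rcases (weightedNorm_nonneg A⁻¹ b.ofLp).eq_or_lt with h0 | hpos
  · rw [← h0]
    positivity
  set y : EuclideanSpace ℝ n := WithLp.toLp 2 (A⁻¹ *ᵥ b.ofLp) with hy
  have hyb : m * ‖y‖ ≤ weightedNorm A⁻¹ b.ofLp := weightedNorm_inv_mulVec hA b.ofLp ▸ h y
  have hsq : weightedNorm A⁻¹ b.ofLp ^ 2 ≤ ‖b‖ * ‖y‖ := by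
    rw [sq_weightedNorm hA.inv.posSemidef]
    simpa [PiLp.inner_apply, dotProduct, mul_comm, hy] using real_inner_le_norm b y
  rw [le_div_iff₀ hm]
  refine le_of_mul_le_mul_right ?_ hpos
  calc weightedNorm A⁻¹ b.ofLp * m * weightedNorm A⁻¹ b.ofLp
      = m * weightedNorm A⁻¹ b.ofLp ^ 2 := by ring
    _ ≤ m * (‖b‖ * ‖y‖) := by gcongr
    _ = ‖b‖ * (m * ‖y‖) := by ring
    _ ≤ ‖b‖ * weightedNorm A⁻¹ b.ofLp := by gcongr

theorem det_le_trace_div_card_pow [Nonempty n] (hA : A.PosSemidef) :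
    A.det ≤ (A.trace / Fintype.card n) ^ Fintype.card n := by
  have hdet : A.det = ∏ i, hA.1.eigenvalues i := by
    simpa using hA.1.det_eq_prod_eigenvalues
  have htrace : A.trace = ∑ i, hA.1.eigenvalues i := by
    simpa using hA.1.trace_eq_sum_eigenvalues
  have hcard : (0 : ℝ) < Fintype.card n := by exact_mod_cast Fintype.card_pos
  have hprod : 0 ≤ ∏ i, hA.1.eigenvalues i :=
    Finset.prod_nonneg fun i _ => hA.eigenvalues_nonneg i
  have amgm := Real.geom_mean_le_arith_mean Finset.univ (fun _ => (1 : ℝ)) hA.1.eigenvalues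
    (fun _ _ => zero_le_one) (by simpa using hcard) (fun i _ => hA.eigenvalues_nonneg i)
  simp only [Real.rpow_one, Finset.sum_const, Finset.card_univ, nsmul_eq_mul, mul_one,
    one_mul] at amgm
  rw [htrace, hdet]
  calc ∏ i, hA.1.eigenvalues i
      = ((∏ i, hA.1.eigenvalues i) ^ ((Fintype.card n : ℝ)⁻¹)) ^ Fintype.card n := by
        rw [← Real.rpow_natCast, ← Real.rpow_mul hprod, inv_mul_cancel₀ hcard.ne', Real.rpow_one]
    _ ≤ _ := pow_le_pow_left₀ (Real.rpow_nonneg hprod _) amgm _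

end WeightedNorm

section GaussianIntegral

variable {n : Type*} [Fintype n]

theorem lintegral_exp_neg_dotProduct_self_div_two :
    ∫⁻ x : n → ℝ, ENNReal.ofReal (Real.exp (-(x ⬝ᵥ x) / 2))
      = ENNReal.ofReal (√(2 * Real.pi) ^ Fintype.card n) := by
  have hexp (x : n → ℝ) : Real.exp (-(x ⬝ᵥ x) / 2) = ∏ i, Real.exp (-(1 / 2) * x i ^ 2) := by
    rw [← Real.exp_sum, dotProduct, ← Finset.mul_sum]
    congr 1
    simp only [sq]
    ring
  have hint : Integrable fun x : n → ℝ => ∏ i, Real.exp (-(1 / 2) * x i ^ 2) :=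
    Integrable.fintype_prod fun _ => integrable_exp_neg_mul_sq one_half_pos
  simp_rw [hexp]
  rw [← ofReal_integral_eq_lintegral_ofReal hint
    (.of_forall fun x => Finset.prod_nonneg fun i _ => (Real.exp_pos _).le),
    integral_fintype_prod_volume_eq_prod (fun (_ : n) (x : ℝ) => Real.exp (-(1 / 2) * x ^ 2))]
  simp only [integral_gaussian, Finset.prod_const, Finset.card_univ]
  congr 4
  ring

variable [DecidableEq n]

theorem lintegral_comp_mulVec {C : Matrix n n ℝ} (hC : C.det ≠ 0) {f : (n → ℝ) → ENNReal}
    (hf : Measurable f) :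
    ∫⁻ x, f (C *ᵥ x) = ENNReal.ofReal |C.det⁻¹| * ∫⁻ x, f x := by
  have hmul : Measurable fun x : n → ℝ => C *ᵥ x :=
    (Continuous.matrix_mulVec continuous_const continuous_id).measurable
  have hmap := Real.map_matrix_volume_pi_eq_smul_volume_pi hC
  rw [← smul_eq_mul, ← lintegral_smul_measure, ← hmap]
  exact (lintegral_map hf hmul).symm

theorem dotProduct_sub_quadratic_eq {M : Matrix n n ℝ} (hM : M.PosDef) (s x : n → ℝ) :
    s ⬝ᵥ x - x ⬝ᵥ (M *ᵥ x) / 2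
      = s ⬝ᵥ (M⁻¹ *ᵥ s) / 2 - (x - M⁻¹ *ᵥ s) ⬝ᵥ (M *ᵥ (x - M⁻¹ *ᵥ s)) / 2 := by
  have hcross : (M⁻¹ *ᵥ s) ⬝ᵥ (M *ᵥ x) = s ⬝ᵥ x := by
    have hMt : Mᵀ = M := by
      rw [← Matrix.conjTranspose_eq_transpose_of_trivial]
      exact hM.1
    rw [Matrix.dotProduct_mulVec, ← Matrix.mulVec_transpose, hMt, mulVec_inv_mulVec hM]
  simp only [Matrix.mulVec_sub, dotProduct_sub, sub_dotProduct, mulVec_inv_mulVec hM, hcross]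
  rw [dotProduct_comm x s, dotProduct_comm (M⁻¹ *ᵥ s) s]
  ring

theorem lintegral_exp_dotProduct_sub_quadratic {M : Matrix n n ℝ} (hM : M.PosDef) (s : n → ℝ) :
    ∫⁻ x : n → ℝ, ENNReal.ofReal (Real.exp (s ⬝ᵥ x - x ⬝ᵥ (M *ᵥ x) / 2))
      = ENNReal.ofReal (Real.exp (weightedNorm M⁻¹ s ^ 2 / 2) / √M.det)
        * ENNReal.ofReal (√(2 * Real.pi) ^ Fintype.card n) := by
  obtain ⟨C, hC⟩ := exists_eq_transpose_mul_self hM.posSemidef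
  have hdet : M.det = C.det ^ 2 := by rw [hC, Matrix.det_mul, Matrix.det_transpose, sq]
  have hC0 : C.det ≠ 0 := fun h => hM.det_pos.ne' (by rw [hdet, h, zero_pow two_ne_zero])
  set f : (n → ℝ) → ENNReal := fun x => ENNReal.ofReal (Real.exp (-(x ⬝ᵥ x) / 2)) with hf
  have hf_meas : Measurable f := by
    simp only [hf, dotProduct]
    fun_prop
  have hfactor (x : n → ℝ) : ENNReal.ofReal (Real.exp (s ⬝ᵥ x - x ⬝ᵥ (M *ᵥ x) / 2))
      = ENNReal.ofReal (Real.exp (weightedNorm M⁻¹ s ^ 2 / 2)) * f (C *ᵥ (x - M⁻¹ *ᵥ s)) := by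
    rw [hf, ← ENNReal.ofReal_mul (Real.exp_pos _).le, ← Real.exp_add,
      ← dotProduct_transpose_mul_self_mulVec, ← hC, dotProduct_sub_quadratic_eq hM,
      sq_weightedNorm hM.inv.posSemidef]
    ring_nf
  have hmul : Measurable fun x : n → ℝ => C *ᵥ x :=
    (Continuous.matrix_mulVec continuous_const continuous_id).measurable
  simp_rw [hfactor]
  rw [lintegral_const_mul _ (by fun_prop), lintegral_sub_right_eq_self (fun x => f (C *ᵥ x)),
    lintegral_comp_mulVec hC0 hf_meas, lintegral_exp_neg_dotProduct_self_div_two, ← mul_assoc,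
    ← ENNReal.ofReal_mul (Real.exp_pos _).le, hdet, Real.sqrt_sq_eq_abs, abs_inv,
    ← div_eq_mul_inv]

end GaussianIntegral

section ConditionalBound

variable {Ω : Type*} {m m0 : MeasurableSpace Ω} {P : Measure Ω} {g : Ω → ENNReal}

/-- The statement `E[g | m] ≤ 1` for a function with values in `[0, ∞]`, tested on the events of
`m`; this avoids integrability conditions. -/
def CondExpLeOne (m : MeasurableSpace Ω) {_ : MeasurableSpace Ω} (P : Measure Ω)
    (g : Ω → ENNReal) : Prop :=
  ∀ A, MeasurableSet[m] A → ∫⁻ ω in A, g ω ∂P ≤ P A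

theorem CondExpLeOne.of_condExp_le [IsFiniteMeasure P] (hm : m ≤ m0) {Y : Ω → ℝ}
    (hY : Integrable Y P) (hY0 : 0 ≤ᵐ[P] Y) {C : ℝ} (hC : 0 < C)
    (h : P[Y | m] ≤ᵐ[P] fun _ => C) :
    CondExpLeOne m P fun ω => ENNReal.ofReal (Y ω / C) := by
  intro A hA
  have hle : ∫ ω in A, Y ω ∂P ≤ C * P.real A := calc
    ∫ ω in A, Y ω ∂P = ∫ ω in A, (P[Y | m]) ω ∂P := (setIntegral_condExp hm hY hA).symm
    _ ≤ ∫ _ in A, C ∂P := integral_mono_ae integrable_condExp.integrableOn (integrable_const _)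
        (ae_restrict_of_ae h)
    _ = C * P.real A := by simp [mul_comm]
  rw [← ofReal_integral_eq_lintegral_ofReal (hY.div_const C).integrableOn
    (ae_restrict_of_ae (hY0.mono fun ω hω => div_nonneg hω hC.le)), ← ofReal_measureReal]
  refine ENNReal.ofReal_le_ofReal ?_
  rwa [integral_div, div_le_iff₀' hC]

theorem CondExpLeOne.lintegral_mul_le (h : CondExpLeOne m P g) (hm : m ≤ m0) (hg : Measurable g)
    {W : Ω → ENNReal} (hW : Measurable[m] W) :
    ∫⁻ ω, W ω * g ω ∂P ≤ ∫⁻ ω, W ω ∂P := by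
  have htrim : (P.withDensity g).trim hm ≤ P.trim hm := by
    refine Measure.le_iff.2 fun A hA => ?_
    rw [trim_measurableSet_eq hm hA, trim_measurableSet_eq hm hA, withDensity_apply _ (hm _ hA)]
    exact h A hA
  calc ∫⁻ ω, W ω * g ω ∂P = ∫⁻ ω, W ω ∂(P.withDensity g) := by
        rw [lintegral_withDensity_eq_lintegral_mul _ hg (hW.mono hm le_rfl)]
        simp only [Pi.mul_apply, mul_comm]
    _ = ∫⁻ ω, W ω ∂((P.withDensity g).trim hm) := (lintegral_trim hm hW).symm
    _ ≤ ∫⁻ ω, W ω ∂(P.trim hm) := lintegral_mono' htrim le_rfl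
    _ = ∫⁻ ω, W ω ∂P := lintegral_trim hm hW

theorem CondExpLeOne.comp_of_finite_range {E : Type*} {F : E → Ω → ENNReal} (hm : m ≤ m0)
    (h : ∀ c, CondExpLeOne m P (F c)) {t : Ω → E} (hfin : (Set.range t).Finite)
    (ht : ∀ c, MeasurableSet[m] (t ⁻¹' {c})) : CondExpLeOne m P fun ω => F (t ω) ω := by
  intro A hA
  have hfiber (c : E) : MeasurableSet[m] (t ⁻¹' {c} ∩ A) := (ht c).inter hA
  have hdisj : Set.PairwiseDisjoint (hfin.toFinset : Set E) fun c => t ⁻¹' {c} ∩ A := by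
    intro c _ c' _ hcc'
    refine Set.disjoint_left.2 fun ω hω hω' => hcc' ?_
    exact hω.1.symm.trans hω'.1
  have hA_eq : A = ⋃ c ∈ hfin.toFinset, t ⁻¹' {c} ∩ A := by
    ext ω
    simp
  conv_lhs => rw [hA_eq]
  conv_rhs => rw [hA_eq]
  rw [lintegral_biUnion_finset hdisj fun c _ => hm _ (hfiber c),
    measure_biUnion_finset hdisj fun c _ => hm _ (hfiber c)]
  refine Finset.sum_le_sum fun c _ => ?_
  calc ∫⁻ ω in t ⁻¹' {c} ∩ A, F (t ω) ω ∂P = ∫⁻ ω in t ⁻¹' {c} ∩ A, F c ω ∂P :=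
        setLIntegral_congr_fun (hm _ (hfiber c)) fun ω hω => by
          rw [show t ω = c from hω.1]
    _ ≤ P (t ⁻¹' {c} ∩ A) := h c _ (hfiber c)

theorem CondExpLeOne.comp_stronglyMeasurable {E : Type*} [TopologicalSpace E]
    {F : E → Ω → ENNReal} (hm : m ≤ m0) (hF : ∀ c, Measurable (F c))
    (hcont : ∀ ω, Continuous fun c => F c ω) (h : ∀ c, CondExpLeOne m P (F c)) {s : Ω → E}
    (hs : StronglyMeasurable[m] s) : CondExpLeOne m P fun ω => F (s ω) ω := by
  intro A hA
  have hfin (k : ℕ) : (Set.range fun ω => hs.approx k ω).Finite :=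
    @SimpleFunc.finite_range Ω E m (hs.approx k)
  have hfiber (k : ℕ) (c : E) : MeasurableSet[m] ((fun ω => hs.approx k ω) ⁻¹' {c}) :=
    @SimpleFunc.measurableSet_fiber Ω E m (hs.approx k) c
  have hmeas (k : ℕ) : Measurable fun ω => F (hs.approx k ω) ω :=
    SimpleFunc.measurable_bind ⟨fun ω => hs.approx k ω, fun c => hm _ (hfiber k c), hfin k⟩ F hF
  calc ∫⁻ ω in A, F (s ω) ω ∂P
      = ∫⁻ ω in A, Filter.liminf (fun k => F (hs.approx k ω) ω) Filter.atTop ∂P :=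
        lintegral_congr fun ω =>
          (((hcont ω).tendsto _).comp (hs.tendsto_approx ω)).liminf_eq.symm
    _ ≤ Filter.liminf (fun k => ∫⁻ ω in A, F (hs.approx k ω) ω ∂P) Filter.atTop :=
        lintegral_liminf_le hmeas
    _ ≤ Filter.liminf (fun _ : ℕ => P A) Filter.atTop :=
        Filter.liminf_le_liminf (.of_forall fun k =>
          CondExpLeOne.comp_of_finite_range hm h (hfin k) (hfiber k) A hA)
    _ = P A := Filter.liminf_const _

theorem lintegral_prod_le_one [IsProbabilityMeasure P] {ι : Type*} {ℱ : Filtration ℕ m0}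
    {t : ι → ℕ} (ht : Function.Injective t) {F : ι → Ω → ENNReal}
    (hF : ∀ p, Measurable[ℱ (t p + 1)] (F p)) (h : ∀ p, CondExpLeOne (ℱ (t p)) P (F p))
    (V : Finset ι) :
    ∫⁻ ω, ∏ p ∈ V, F p ω ∂P ≤ 1 := by
  classical
  induction V using Finset.induction_on_max_value t with
  | empty => simp
  | insert p V hpV hmax ih =>
    have hlt (q : ι) (hq : q ∈ V) : t q < t p :=
      (hmax q hq).lt_of_ne fun hqp => hpV (ht hqp ▸ hq)
    have hpast : Measurable[ℱ (t p)] fun ω => ∏ q ∈ V, F q ω :=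
      Finset.measurable_fun_prod _ fun q hq => (hF q).mono (ℱ.mono (hlt q hq)) le_rfl
    simp_rw [Finset.prod_insert hpV, mul_comm (F p _)]
    exact ((h p).lintegral_mul_le (ℱ.le _) ((hF p).mono (ℱ.le _) le_rfl) hpast).trans ih

end ConditionalBound

section MethodOfMixtures

theorem posDef_smul_one_add {n : Type*} [DecidableEq n] {lam : ℝ} (hlam : 0 < lam)
    {G : Matrix n n ℝ} (hG : G.PosSemidef) :
    (lam • (1 : Matrix n n ℝ) + G).PosDef :=
  (Matrix.PosDef.one.smul hlam).add_posSemidef hG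

variable {n : Type*} [Fintype n]

theorem measurable_exp_dotProduct_sub_quadratic {Ω : Type*} [MeasurableSpace Ω] {s : Ω → n → ℝ}
    {G : Ω → Matrix n n ℝ} (hs : Measurable s) (hG : ∀ i j, Measurable fun ω => G ω i j) :
    Measurable fun p : Ω × (n → ℝ) =>
      ENNReal.ofReal (Real.exp (s p.1 ⬝ᵥ p.2 - p.2 ⬝ᵥ (G p.1 *ᵥ p.2) / 2)) := by
  have (i j : n) : Measurable fun p : Ω × (n → ℝ) => G p.1 i j := (hG i j).comp measurable_fst
  simp only [dotProduct, Matrix.mulVec]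
  fun_prop

variable {lam : ℝ}

theorem lintegral_exp_mul_gaussianPrior [DecidableEq n] (hlam : 0 < lam) {G : Matrix n n ℝ}
    (hG : G.PosSemidef) (s : n → ℝ) :
    ∫⁻ x : n → ℝ, ENNReal.ofReal (Real.exp (s ⬝ᵥ x - x ⬝ᵥ (G *ᵥ x) / 2))
        * ENNReal.ofReal (Real.exp (-(lam * (x ⬝ᵥ x)) / 2))
      = ENNReal.ofReal (Real.exp (weightedNorm (lam • 1 + G)⁻¹ s ^ 2 / 2) / √(lam • 1 + G).det)
        * ENNReal.ofReal (√(2 * Real.pi) ^ Fintype.card n) := by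
  rw [← lintegral_exp_dotProduct_sub_quadratic (posDef_smul_one_add hlam hG)]
  refine lintegral_congr fun x => ?_
  rw [← ENNReal.ofReal_mul (Real.exp_pos _).le, ← Real.exp_add, Matrix.add_mulVec,
    Matrix.smul_mulVec, Matrix.one_mulVec, dotProduct_add, dotProduct_smul, smul_eq_mul]
  ring_nf

theorem lintegral_gaussianPrior (hlam : 0 < lam) :
    ∫⁻ x : n → ℝ, ENNReal.ofReal (Real.exp (-(lam * (x ⬝ᵥ x)) / 2))
      = ENNReal.ofReal (1 / √(lam ^ Fintype.card n))
        * ENNReal.ofReal (√(2 * Real.pi) ^ Fintype.card n) := by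
  classical
  simpa [weightedNorm] using
    lintegral_exp_mul_gaussianPrior hlam (Matrix.PosSemidef.zero (n := n)) 0

variable [DecidableEq n] {Ω : Type*} [MeasurableSpace Ω] {P : Measure Ω} [SFinite P]
  {s : Ω → n → ℝ} {G : Ω → Matrix n n ℝ}

theorem measure_le_exp_weightedNorm_div_sqrt_det_le (hlam : 0 < lam) (hs : Measurable s)
    (hG : ∀ i j, Measurable fun ω => G ω i j) (hG_psd : ∀ ω, (G ω).PosSemidef)
    (hexp : ∀ x, ∫⁻ ω, ENNReal.ofReal (Real.exp (s ω ⬝ᵥ x - x ⬝ᵥ (G ω *ᵥ x) / 2)) ∂P ≤ 1)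
    {ε : ℝ} (hε : 0 < ε) :
    P {ω | 1 / √(lam ^ Fintype.card n) / ε
        ≤ Real.exp (weightedNorm (lam • 1 + G ω)⁻¹ (s ω) ^ 2 / 2) / √(lam • 1 + G ω).det}
      ≤ ENNReal.ofReal ε := by
  set g : Ω → (n → ℝ) → ENNReal := fun ω x =>
    ENNReal.ofReal (Real.exp (s ω ⬝ᵥ x - x ⬝ᵥ (G ω *ᵥ x) / 2)) with hg
  set h : (n → ℝ) → ENNReal := fun x => ENNReal.ofReal (Real.exp (-(lam * (x ⬝ᵥ x)) / 2)) with hh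
  set κ : ENNReal := ENNReal.ofReal (√(2 * Real.pi) ^ Fintype.card n)
  have hκ0 : κ ≠ 0 := (ENNReal.ofReal_pos.2 (by positivity)).ne'
  have hg_meas : Measurable (Function.uncurry g) := measurable_exp_dotProduct_sub_quadratic hs hG
  have hh_meas : Measurable h := by
    simp only [hh, dotProduct]
    fun_prop
  have hgh_meas : Measurable (Function.uncurry fun ω x => g ω x * h x) :=
    hg_meas.mul (hh_meas.comp measurable_snd)
  have hmix : ∫⁻ ω, (∫⁻ x, g ω x * h x) ∂P ≤ ENNReal.ofReal (1 / √(lam ^ Fintype.card n)) * κ := by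
    rw [lintegral_lintegral_swap hgh_meas.aemeasurable, ← lintegral_gaussianPrior hlam]
    refine lintegral_mono fun x => ?_
    have hgx : Measurable fun ω => g ω x := hg_meas.comp measurable_prodMk_right
    rw [lintegral_mul_const _ hgx]
    exact mul_le_of_le_one_left zero_le (hexp x)
  have hmarkov := meas_ge_le_lintegral_div (μ := P)
    (hgh_meas.lintegral_prod_right (ν := volume)).aemeasurable
    (ε := ENNReal.ofReal (1 / √(lam ^ Fintype.card n) / ε) * κ)
    (mul_ne_zero (ENNReal.ofReal_pos.2 (by positivity)).ne' hκ0)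
    (ENNReal.mul_ne_top ENNReal.ofReal_ne_top ENNReal.ofReal_ne_top)
  refine (measure_mono fun ω hω => ?_).trans (hmarkov.trans ?_)
  · change _ ≤ ∫⁻ x, g ω x * h x
    rw [hg, hh, lintegral_exp_mul_gaussianPrior hlam (hG_psd ω)]
    exact mul_le_mul_left (ENNReal.ofReal_le_ofReal hω) _
  · refine ENNReal.div_le_of_le_mul (hmix.trans_eq ?_)
    rw [← mul_assoc, ← ENNReal.ofReal_mul hε.le, mul_div_cancel₀ _ hε.ne']

theorem measure_log_det_add_lt_weightedNorm_sq_le (hlam : 0 < lam) (hs : Measurable s)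
    (hG : ∀ i j, Measurable fun ω => G ω i j) (hG_psd : ∀ ω, (G ω).PosSemidef)
    (hexp : ∀ x, ∫⁻ ω, ENNReal.ofReal (Real.exp (s ω ⬝ᵥ x - x ⬝ᵥ (G ω *ᵥ x) / 2)) ∂P ≤ 1)
    {ε : ℝ} (hε : 0 < ε) :
    P {ω | Real.log ((lam • 1 + G ω).det / lam ^ Fintype.card n) + 2 * Real.log (1 / ε)
        < weightedNorm (lam • 1 + G ω)⁻¹ (s ω) ^ 2} ≤ ENNReal.ofReal ε := by
  refine (measure_mono fun ω hω => ?_).trans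
    (measure_le_exp_weightedNorm_div_sqrt_det_le hlam hs hG hG_psd hexp hε)
  rw [Set.mem_ofPred_eq] at hω ⊢
  have hdet : 0 < (lam • 1 + G ω).det := (posDef_smul_one_add hlam (hG_psd ω)).det_pos
  have hsqrt : √((lam • 1 + G ω).det / lam ^ Fintype.card n)
      = Real.exp (Real.log ((lam • 1 + G ω).det / lam ^ Fintype.card n) / 2) := by
    rw [Real.exp_half, Real.exp_log (by positivity)]
  have hinv : 1 / ε = Real.exp (Real.log (1 / ε)) := (Real.exp_log (by positivity)).symm
  rw [le_div_iff₀ (Real.sqrt_pos.2 hdet)]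
  calc 1 / √(lam ^ Fintype.card n) / ε * √(lam • 1 + G ω).det
      = √((lam • 1 + G ω).det / lam ^ Fintype.card n) * (1 / ε) := by
        rw [Real.sqrt_div hdet.le]
        ring
    _ = Real.exp (Real.log ((lam • 1 + G ω).det / lam ^ Fintype.card n) / 2
          + Real.log (1 / ε)) := by rw [Real.exp_add, hsqrt, ← hinv]
    _ ≤ Real.exp (weightedNorm (lam • 1 + G ω)⁻¹ (s ω) ^ 2 / 2) := by
        gcongr
        linarith

theorem log_det_smul_one_add_div_le (hlam : 0 < lam) {G : Matrix n n ℝ} (hG : G.PosSemidef) :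
    Real.log ((lam • 1 + G).det / lam ^ Fintype.card n)
      ≤ Fintype.card n * Real.log (1 + G.trace / (lam * Fintype.card n)) := by
  have hM := posDef_smul_one_add hlam hG
  rcases isEmpty_or_nonempty n with _ | _
  · simp
  have : (0 : ℝ) < Fintype.card n := by exact_mod_cast Fintype.card_pos
  have htrace : (lam • 1 + G).trace / Fintype.card n
      = lam * (1 + G.trace / (lam * Fintype.card n)) := by
    rw [Matrix.trace_add, Matrix.trace_smul, Matrix.trace_one, smul_eq_mul]
    field_simp
  rw [← Real.log_pow]
  refine Real.log_le_log (div_pos hM.det_pos (by positivity)) ?_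
  rw [div_le_iff₀' (by positivity), ← mul_pow, ← htrace]
  exact det_le_trace_div_card_pow hM.posSemidef

end MethodOfMixtures

section Net

open Module

variable {E : Type*} [NormedAddCommGroup E] [NormedSpace ℝ E] [FiniteDimensional ℝ E]

theorem card_le_of_separated_of_norm_le_one {ε : ℝ} (hε : 0 < ε) (s : Finset E)
    (hs : ∀ c ∈ s, ‖c‖ ≤ 1) (hsep : (s : Set E).Pairwise fun c c' => ε ≤ ‖c - c'‖) :
    (s.card : ℝ) ≤ (1 + 2 / ε) ^ finrank ℝ E := by
  borelize E
  let μ : Measure E := Measure.addHaar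
  have hr : 0 < ε / 2 := by positivity
  have hR : 0 < 1 + ε / 2 := by positivity
  have hdisj : (s : Set E).PairwiseDisjoint fun c => Metric.ball c (ε / 2) := by
    intro c hc c' hc' hcc
    refine Metric.ball_disjoint_ball ?_
    rw [dist_eq_norm, add_halves]
    exact hsep hc hc' hcc
  have hsub : (⋃ c ∈ s, Metric.ball c (ε / 2)) ⊆ Metric.ball 0 (1 + ε / 2) := by
    refine Set.iUnion₂_subset fun c hc => Metric.ball_subset_ball' ?_
    rw [dist_zero_right, add_comm]
    gcongr
    exact hs c hc
  have hvol : (s.card : ENNReal) * ENNReal.ofReal ((ε / 2) ^ finrank ℝ E) * μ (Metric.ball 0 1)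
      ≤ ENNReal.ofReal ((1 + ε / 2) ^ finrank ℝ E) * μ (Metric.ball 0 1) := by
    calc _ = μ (⋃ c ∈ s, Metric.ball c (ε / 2)) := by
          rw [measure_biUnion_finset hdisj fun c _ => measurableSet_ball]
          simp only [Measure.addHaar_ball_of_pos μ _ hr, Finset.sum_const, nsmul_eq_mul, mul_assoc]
      _ ≤ μ (Metric.ball 0 (1 + ε / 2)) := measure_mono hsub
      _ = _ := Measure.addHaar_ball_of_pos μ _ hR
  have hcard := ENNReal.toReal_le_of_le_ofReal (by positivity)
    ((ENNReal.mul_le_mul_iff_left (Metric.measure_ball_pos μ 0 one_pos).ne'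
      measure_ball_lt_top.ne).1 hvol)
  rw [ENNReal.toReal_mul, ENNReal.toReal_natCast, ENNReal.toReal_ofReal (by positivity)] at hcard
  have hratio : 1 + 2 / ε = (1 + ε / 2) / (ε / 2) := by
    field_simp
    ring
  rwa [hratio, div_pow, le_div_iff₀ (by positivity)]

theorem exists_finset_net_card_le {ε : ℝ} (hε : 0 < ε) {K : Set E}
    (hK : K ⊆ Metric.closedBall 0 1) :
    ∃ s : Finset E, (s : Set E) ⊆ K ∧ (∀ v ∈ K, ∃ w ∈ s, ‖v - w‖ ≤ ε) ∧
      (s.card : ℝ) ≤ (1 + 2 / ε) ^ finrank ℝ E := by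
  lift ε to NNReal using hε.le
  have hε' : ε / 2 ≠ 0 := (half_pos (NNReal.coe_pos.1 hε)).ne'
  obtain ⟨N, -, hN, hNcover⟩ := Metric.exists_finite_isCover_of_totallyBounded hε'
    ((ProperSpace.isCompact_closedBall (0 : E) 1).totallyBounded.subset hK)
  have hpack : Metric.packingNumber ε K ≠ ⊤ := by
    have h := (Metric.packingNumber_two_mul_le_externalCoveringNumber (ε / 2) K).trans
      hNcover.externalCoveringNumber_le_encard
    rw [mul_div_cancel₀ ε two_ne_zero] at h
    exact (h.trans_lt hN.encard_lt_top).ne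
  have hfin : (Metric.maximalSeparatedSet ε K).Finite :=
    Set.encard_ne_top_iff.1 ((Metric.encard_maximalSeparatedSet hpack).trans_ne hpack)
  have hsub : (hfin.toFinset : Set E) ⊆ K :=
    hfin.coe_toFinset.trans_subset Metric.maximalSeparatedSet_subset
  refine ⟨hfin.toFinset, hsub, fun v hv => ?_, ?_⟩
  · obtain ⟨w, hw, hvw⟩ := Metric.isCover_maximalSeparatedSet hpack hv
    refine ⟨w, hfin.mem_toFinset.2 hw, ?_⟩
    rwa [← dist_eq_norm, ← coe_nndist, NNReal.coe_le_coe, ← ENNReal.coe_le_coe,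
      ← edist_nndist]
  · refine card_le_of_separated_of_norm_le_one hε _
      (fun c hc => mem_closedBall_zero_iff.1 (hK (hsub hc))) fun c hc c' hc' hcc => ?_
    have h : (ε : ENNReal) < edist c c' := Metric.isSeparated_maximalSeparatedSet
      (hfin.mem_toFinset.1 hc) (hfin.mem_toFinset.1 hc') hcc
    rw [edist_nndist, ENNReal.coe_lt_coe, ← NNReal.coe_lt_coe, coe_nndist,
      dist_eq_norm] at h
    exact h.le

end Net

section Chernoff

variable {Ω : Type*} [MeasurableSpace Ω] {P : Measure Ω} [IsProbabilityMeasure P]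

theorem mgf_le_exp_of_mem_Icc {Y : Ω → ℝ} (hY : AEMeasurable Y P)
    (hY01 : ∀ᵐ ω ∂P, Y ω ∈ Set.Icc (0 : ℝ) 1) (t : ℝ) :
    mgf Y P t ≤ Real.exp ((Real.exp t - 1) * P[Y]) := by
  have hint : Integrable Y P := Integrable.of_mem_Icc 0 1 hY hY01
  have hconv : ∀ y ∈ Set.Icc (0 : ℝ) 1, Real.exp (t * y) ≤ 1 + (Real.exp t - 1) * y := by
    intro y hy
    have h := convexOn_exp.2 (Set.mem_univ (0 : ℝ)) (Set.mem_univ t)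
      (sub_nonneg.2 hy.2) hy.1 (by ring)
    simp only [smul_eq_mul, mul_zero, zero_add, Real.exp_zero, mul_one] at h
    rw [mul_comm t y]
    linarith
  calc mgf Y P t ≤ ∫ ω, (1 + (Real.exp t - 1) * Y ω) ∂P :=
        integral_mono_ae (integrable_exp_mul_of_mem_Icc hY hY01)
          ((integrable_const _).add (hint.const_mul _)) (hY01.mono fun ω hω => hconv _ hω)
    _ = (Real.exp t - 1) * P[Y] + 1 := by
        rw [integral_add (integrable_const _) (hint.const_mul _), integral_const_mul,
          integral_const, probReal_univ, one_smul, add_comm]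
    _ ≤ _ := Real.add_one_le_exp _

theorem measureReal_sum_le_le_exp {ι : Type*} [Fintype ι] {Y : ι → Ω → ℝ}
    (hind : iIndepFun Y P) (hY : ∀ i, Measurable (Y i))
    (hY01 : ∀ i, ∀ᵐ ω ∂P, Y i ω ∈ Set.Icc (0 : ℝ) 1) {t : ℝ} (ht : t ≤ 0) (a : ℝ) :
    P.real {ω | ∑ i, Y i ω ≤ a}
      ≤ Real.exp (-t * a + (Real.exp t - 1) * ∑ i, P[Y i]) := by
  have hint : Integrable (fun ω => Real.exp (t * (∑ i, Y i) ω)) P :=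
    hind.integrable_exp_mul_sum hY fun i _ =>
      integrable_exp_mul_of_mem_Icc (hY i).aemeasurable (hY01 i)
  have hchernoff := measure_le_le_exp_mul_mgf a ht hint
  rw [hind.mgf_sum hY] at hchernoff
  simp only [Finset.sum_apply] at hchernoff
  calc _ ≤ Real.exp (-t * a) * ∏ i, mgf (Y i) P t := hchernoff
    _ ≤ Real.exp (-t * a) * ∏ i, Real.exp ((Real.exp t - 1) * P[Y i]) := by
        gcongr with i
        · exact fun i _ => mgf_nonneg
        · exact mgf_le_exp_of_mem_Icc (hY i).aemeasurable (hY01 i) t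
    _ = _ := by rw [← Real.exp_sum, ← Real.exp_add, Finset.mul_sum]

theorem exp_neg_half_le : Real.exp (-(1 / 2)) ≤ 39 / 64 := by
  have hsq : Real.exp (-(1 / 2)) ^ 2 = Real.exp (-1) := by
    rw [← Real.exp_nat_mul]
    norm_num
  refine le_of_sq_le_sq ?_ (by norm_num)
  rw [hsq]
  linarith [Real.exp_neg_one_lt_d9]

-- The Chernoff exponent at `t = -1/2` is `9/32 - 25/64 = -7/64` per unit of `l * card ι`.
theorem measureReal_sum_le_nine_sixteenths_le_exp {ι : Type*} [Fintype ι] {Y : ι → Ω → ℝ}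
    (hind : iIndepFun Y P) (hY : ∀ i, Measurable (Y i))
    (hY01 : ∀ i, ∀ᵐ ω ∂P, Y i ω ∈ Set.Icc (0 : ℝ) 1) {l : ℝ} (hl0 : 0 ≤ l)
    (hl : ∀ i, l ≤ P[Y i]) :
    P.real {ω | ∑ i, Y i ω ≤ 9 / 16 * l * Fintype.card ι}
      ≤ Real.exp (-(7 / 64 * l * Fintype.card ι)) := by
  have hsum : Fintype.card ι * l ≤ ∑ i, P[Y i] := by
    simpa [nsmul_eq_mul] using Finset.card_nsmul_le_sum Finset.univ (fun i => P[Y i]) l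
      fun i _ => hl i
  refine (measureReal_sum_le_le_exp hind hY hY01 (t := -(1 / 2)) (by norm_num) _).trans
    (Real.exp_le_exp.2 ?_)
  have hcoef : (Real.exp (-(1 / 2)) - 1) * ∑ i, P[Y i] ≤ -(25 / 64) * (Fintype.card ι * l) := by
    have hpos : 0 ≤ Fintype.card ι * l := by positivity
    nlinarith [exp_neg_half_le]
  linarith

end Chernoff

section BlockIndependence

variable {Ω : Type*} [MeasurableSpace Ω] {P : Measure Ω}
  {ι : Type*} {κ : ι → Type*} {E : Type*} [MeasurableSpace E] {c : (i : ι) → κ i → Ω → E}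

theorem iIndepFun_block (hind : iIndepFun (fun p : (i : ι) × κ i => c p.1 p.2) P) (i : ι) :
    iIndepFun (c i) P :=
  hind.precomp (g := fun j => (⟨i, j⟩ : (i : ι) × κ i)) sigma_mk_injective

theorem iIndepFun_curry [IsProbabilityMeasure P] (hc : ∀ i j, Measurable (c i j))
    (hind : iIndepFun (fun p : (i : ι) × κ i => c p.1 p.2) P) :
    iIndepFun (fun i ω (j : κ i) => c i j ω) P := by
  have hprob : ∀ i j, IsProbabilityMeasure (P.map (c i j)) := fun i j =>
    Measure.isProbabilityMeasure_map (hc i j).aemeasurable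
  have hjoint := (iIndepFun_iff_map_fun_eq_infinitePi_map
    (fun p : (i : ι) × κ i => hc p.1 p.2)).1 hind
  have hblock := fun i =>
    (iIndepFun_iff_map_fun_eq_infinitePi_map (hc i)).1 (iIndepFun_block hind i)
  have hcurry := Measure.infinitePi_map_piCurry (X := fun _ _ => E) fun i j => P.map (c i j)
  have hmeas : Measurable fun ω (p : (i : ι) × κ i) => c p.1 p.2 ω :=
    measurable_pi_iff.2 fun p => hc p.1 p.2
  rw [← hjoint, Measure.map_map (by fun_prop) hmeas] at hcurry
  rw [iIndepFun_iff_map_fun_eq_infinitePi_map fun i => measurable_pi_iff.2 (hc i)]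
  simp_rw [hblock]
  exact hcurry

end BlockIndependence

section Euclidean

variable {n : Type*} [Fintype n]

theorem dotProduct_ofLp (x y : EuclideanSpace ℝ n) : x.ofLp ⬝ᵥ y.ofLp = ⟪x, y⟫ := by
  rw [EuclideanSpace.inner_eq_star_dotProduct, star_trivial, dotProduct_comm]

theorem dotProduct_ofLp_self (x : EuclideanSpace ℝ n) : x.ofLp ⬝ᵥ x.ofLp = ‖x‖ ^ 2 := by
  rw [dotProduct_ofLp, real_inner_self_eq_norm_sq]

theorem mul_dotProduct_self_le_of_le_spectrum [DecidableEq n] {A : Matrix n n ℝ}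
    (hA : A.IsHermitian) {l : ℝ} (hl : l ∈ lowerBounds (spectrum ℝ A)) (x : n → ℝ) :
    l * (x ⬝ᵥ x) ≤ x ⬝ᵥ (A *ᵥ x) := by
  have hpsd : (A - l • (1 : Matrix n n ℝ)).PosSemidef := by
    refine Matrix.posSemidef_iff_isHermitian_and_spectrum_nonneg.2
      ⟨hA.sub (Matrix.isHermitian_one.smul (IsSelfAdjoint.all l)), fun y hy => ?_⟩
    rw [← Algebra.algebraMap_eq_smul_one, sub_eq_add_neg, add_comm,
      ← spectrum.add_mem_iff] at hy
    exact le_add_iff_nonneg_left l |>.1 (hl hy)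
  have h := hpsd.dotProduct_mulVec_nonneg x
  rwa [star_trivial, Matrix.sub_mulVec, dotProduct_sub, Matrix.smul_mulVec, Matrix.one_mulVec,
    dotProduct_smul, smul_eq_mul, sub_nonneg] at h

end Euclidean

namespace ActionRegular

variable {d : ℕ} {ρ : Measure (Vec d)} {lamA σ : ℝ}

theorem dim_pos (hρ : ActionRegular ρ lamA σ) : 0 < d := by
  refine Nat.pos_of_ne_zero ?_
  rintro rfl
  have hmem := hρ.minEigenvalue.1
  rw [spectrum.of_subsingleton] at hmem
  exact hmem

theorem integrable_mul (hρ : ActionRegular ρ lamA σ) (i j : Fin d) :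
    Integrable (fun a : Vec d => a i * a j) ρ := by
  have := hρ.isProb
  refine Integrable.of_bound (by fun_prop) 1 (hρ.norm_le.mono fun a ha => ?_)
  rw [norm_mul]
  exact mul_le_one₀ ((PiLp.norm_apply_le a i).trans ha) (norm_nonneg _)
    ((PiLp.norm_apply_le a j).trans ha)

theorem dotProduct_secondMoment_mulVec (hρ : ActionRegular ρ lamA σ) (w : Vec d) :
    w.ofLp ⬝ᵥ (secondMoment ρ *ᵥ w.ofLp) = ∫ a, ⟪w, a⟫ ^ 2 ∂ρ := by
  have hexpand : ∀ a : Vec d, ⟪w, a⟫ ^ 2 = ∑ i, ∑ j, w i * w j * (a i * a j) := fun a => by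
    rw [← dotProduct_ofLp, sq, dotProduct, Finset.sum_mul_sum]
    exact Finset.sum_congr rfl fun i _ => Finset.sum_congr rfl fun j _ => by ring
  have hint : ∀ i j, Integrable (fun a : Vec d => w i * w j * (a i * a j)) ρ := fun i j =>
    (hρ.integrable_mul i j).const_mul _
  simp_rw [hexpand]
  rw [integral_finsetSum _ fun i _ => integrable_finsetSum _ fun j _ => hint i j]
  simp only [dotProduct, Matrix.mulVec, secondMoment, Matrix.of_apply, Finset.mul_sum]
  refine Finset.sum_congr rfl fun i _ => ?_
  rw [integral_finsetSum _ fun j _ => hint i j]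
  refine Finset.sum_congr rfl fun j _ => ?_
  rw [integral_const_mul]
  ring

theorem le_integral_inner_sq (hρ : ActionRegular ρ lamA σ) {w : Vec d} (hw : ‖w‖ = 1) :
    lamA ≤ ∫ a, ⟪w, a⟫ ^ 2 ∂ρ := by
  have hherm : (secondMoment ρ).IsHermitian :=
    Matrix.IsHermitian.ext fun i j => by simp [secondMoment, mul_comm]
  have h := mul_dotProduct_self_le_of_le_spectrum hherm hρ.minEigenvalue.2 w.ofLp
  rwa [dotProduct_ofLp_self, hw, one_pow, mul_one, hρ.dotProduct_secondMoment_mulVec] at h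

theorem dim_mul_le_one (hρ : ActionRegular ρ lamA σ) : d * lamA ≤ 1 := by
  have := hρ.isProb
  have hcoord : ∀ i : Fin d, lamA ≤ ∫ a : Vec d, a i * a i ∂ρ := fun i => by
    simpa [EuclideanSpace.inner_single_left, sq] using
      hρ.le_integral_inner_sq (w := EuclideanSpace.single i 1) (by simp)
  calc d * lamA = ∑ _i : Fin d, lamA := by simp
    _ ≤ ∑ i : Fin d, ∫ a : Vec d, a i * a i ∂ρ := Finset.sum_le_sum fun i _ => hcoord i
    _ = ∫ a : Vec d, a.ofLp ⬝ᵥ a.ofLp ∂ρ :=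
        (integral_finsetSum _ fun i _ => hρ.integrable_mul i i).symm
    _ ≤ ∫ _a : Vec d, (1 : ℝ) ∂ρ := by
        refine integral_mono_ae (integrable_finsetSum _ fun i _ => hρ.integrable_mul i i)
          (integrable_const _) (hρ.norm_le.mono fun a ha => ?_)
        simp only [dotProduct_ofLp_self]
        exact pow_le_one₀ (norm_nonneg _) ha
    _ = 1 := by simp

theorem le_measureReal_lt_inner_sq (hρ : ActionRegular ρ lamA σ) {w : Vec d} (hw : ‖w‖ = 1)
    {x : ℝ} (hx : x ≤ lamA) :
    1 - Real.exp (-(lamA - x) ^ 2 / (2 * σ ^ 2)) ≤ ρ.real {a | x < ⟪w, a⟫ ^ 2} := by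
  have := hρ.isProb
  have hmean := hρ.le_integral_inner_sq hw
  set μ := ∫ a, ⟪w, a⟫ ^ 2 ∂ρ
  have htail := (hρ.tails w hw (μ - x) (sub_nonneg.2 (hx.trans hmean))).2
  have hcompl : {a : Vec d | x < ⟪w, a⟫ ^ 2}ᶜ = {a | ⟪w, a⟫ ^ 2 - μ ≤ -(μ - x)} := by
    ext a
    simp
  have hmeas : MeasurableSet {a : Vec d | x < ⟪w, a⟫ ^ 2} :=
    measurableSet_lt measurable_const (by fun_prop)
  have hexp : Real.exp (-(μ - x) ^ 2 / (2 * σ ^ 2))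
      ≤ Real.exp (-(lamA - x) ^ 2 / (2 * σ ^ 2)) := by
    have : 0 ≤ lamA - x := sub_nonneg.2 hx
    gcongr
  rw [← hcompl, probReal_compl_eq_one_sub hmeas] at htail
  linarith

end ActionRegular

section SmoothedReg

variable {lamA σ : ℝ}

theorem one_sub_exp_neg_mem_Icc (lamA σ x : ℝ) :
    1 - Real.exp (-(lamA - x) ^ 2 / (2 * σ ^ 2)) ∈ Set.Icc (0 : ℝ) 1 := by
  refine ⟨sub_nonneg.2 (Real.exp_le_one_iff.2 ?_), sub_le_self _ (Real.exp_pos _).le⟩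
  rw [neg_div]
  exact neg_nonpos.2 (by positivity)

theorem intervalIntegrable_smoothedReg (lamA σ : ℝ) (S : ℕ) (a b : ℝ) :
    IntervalIntegrable (fun x : ℝ => (1 - Real.exp (-(lamA - x) ^ 2 / (2 * σ ^ 2))) ^ S)
      volume a b :=
  Continuous.intervalIntegrable (by fun_prop) a b

theorem smoothedReg_pos (hl : 0 < lamA) (hσ : 0 < σ) (S : ℕ) : 0 < smoothedReg lamA σ S := by
  refine intervalIntegral.intervalIntegral_pos_of_pos_on
    (intervalIntegrable_smoothedReg lamA σ S _ _) (fun x hx => ?_) hl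
  refine pow_pos (sub_pos.2 (Real.exp_lt_one_iff.2 ?_)) _
  have : 0 < lamA - x := sub_pos.2 hx.2
  rw [neg_div]
  exact neg_lt_zero.2 (by positivity)

theorem smoothedReg_le (hl : 0 ≤ lamA) (S : ℕ) : smoothedReg lamA σ S ≤ lamA := by
  have h := intervalIntegral.integral_mono_on hl
    (intervalIntegrable_smoothedReg lamA σ S 0 lamA) intervalIntegrable_const fun x _ =>
      pow_le_one₀ (one_sub_exp_neg_mem_Icc lamA σ x).1 (one_sub_exp_neg_mem_Icc lamA σ x).2
  simpa [smoothedReg] using h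

end SmoothedReg

theorem ActionRegular.dim_mul_smoothedReg_le_one {d : ℕ} {ρ : Measure (Vec d)} {lamA σ : ℝ}
    (hρ : ActionRegular ρ lamA σ) (S : ℕ) : d * smoothedReg lamA σ S ≤ 1 :=
  (mul_le_mul_of_nonneg_left (smoothedReg_le hρ.lamA_pos.le S) (Nat.cast_nonneg d)).trans
    hρ.dim_mul_le_one

section MinimumOfIndependentCopies

variable {Ω : Type*} [MeasurableSpace Ω] {P : Measure Ω}

theorem intervalIntegral_le_integral_of_le_measureReal_lt [IsProbabilityMeasure P] {Y : Ω → ℝ}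
    (hY : Integrable Y P) (hY0 : 0 ≤ᵐ[P] Y) {g : ℝ → ℝ} {b : ℝ} (hb : 0 ≤ b)
    (hg : IntervalIntegrable g volume 0 b)
    (hgY : ∀ x ∈ Set.Ioc 0 b, 0 ≤ g x ∧ g x ≤ P.real {ω | x < Y ω}) :
    ∫ x in (0 : ℝ)..b, g x ≤ ∫ ω, Y ω ∂P := by
  rw [← ENNReal.ofReal_le_ofReal_iff (integral_nonneg_of_ae hY0),
    ofReal_integral_eq_lintegral_ofReal hY hY0,
    lintegral_eq_lintegral_meas_lt P hY0 hY.aemeasurable,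
    intervalIntegral.integral_of_le hb, ofReal_integral_eq_lintegral_ofReal hg.1
      (ae_restrict_of_forall_mem measurableSet_Ioc fun x hx => (hgY x hx).1)]
  calc _ ≤ ∫⁻ x in Set.Ioc 0 b, P {ω | x < Y ω} :=
        setLIntegral_mono' measurableSet_Ioc fun x hx =>
          ENNReal.ofReal_le_of_le_toReal (hgY x hx).2
    _ ≤ _ := lintegral_mono_set Set.Ioc_subset_Ioi_self

variable {E : Type*} [MeasurableSpace E] {ρ : Measure E} {κ : Type*} [Fintype κ] [Nonempty κ]
  {c : κ → Ω → E} {f : E → ℝ}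

theorem measureReal_lt_iInf_eq_pow (hc : ∀ j, Measurable (c j)) (hlaw : ∀ j, P.map (c j) = ρ)
    (hind : iIndepFun c P) (hf : Measurable f) (x : ℝ) :
    P.real {ω | x < ⨅ j, f (c j ω)} = ρ.real {a | x < f a} ^ Fintype.card κ := by
  have hmeas : MeasurableSet {a | x < f a} := measurableSet_lt measurable_const hf
  have hset : {ω | x < ⨅ j, f (c j ω)} = ⋂ j, c j ⁻¹' {a | x < f a} := by
    ext ω
    simp only [Set.mem_ofPred_eq, Set.mem_iInter, Set.mem_preimage]
    refine ⟨fun h j => h.trans_le (ciInf_le (Set.finite_range _).bddBelow j), fun h => ?_⟩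
    obtain ⟨j, hj⟩ := exists_eq_ciInf_of_finite (f := fun j => f (c j ω))
    exact hj ▸ h j
  rw [measureReal_def, hset, hind.meas_iInter fun j => ⟨_, hmeas, rfl⟩, ENNReal.toReal_prod]
  simp only [← Measure.map_apply (hc _) hmeas, hlaw, Finset.prod_const, Finset.card_univ,
    measureReal_def]

theorem intervalIntegral_pow_le_integral_iInf [IsProbabilityMeasure P]
    (hc : ∀ j, Measurable (c j)) (hlaw : ∀ j, P.map (c j) = ρ) (hind : iIndepFun c P)
    (hf : Measurable f) (hf0 : ∀ a, 0 ≤ f a) (hfint : Integrable f ρ) {p : ℝ → ℝ} {b : ℝ}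
    (hb : 0 ≤ b) {S : ℕ} (hS : Fintype.card κ ≤ S)
    (hpint : IntervalIntegrable (fun x => p x ^ S) volume 0 b)
    (hp : ∀ x ∈ Set.Ioc 0 b, p x ∈ Set.Icc 0 (ρ.real {a | x < f a})) :
    ∫ x in (0 : ℝ)..b, p x ^ S ≤ ∫ ω, ⨅ j, f (c j ω) ∂P := by
  let j₀ : κ := Classical.arbitrary κ
  have : IsProbabilityMeasure ρ :=
    hlaw j₀ ▸ Measure.isProbabilityMeasure_map (hc j₀).aemeasurable
  have hmin0 : ∀ ω, 0 ≤ ⨅ j, f (c j ω) := fun ω => Real.iInf_nonneg fun j => hf0 _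
  have hmin : Integrable (fun ω => ⨅ j, f (c j ω)) P := by
    refine Integrable.mono' ((hlaw j₀ ▸ hfint).comp_measurable (hc j₀))
      (Measurable.iInf fun j => hf.comp (hc j)).aestronglyMeasurable
      (ae_of_all _ fun ω => ?_)
    rw [Real.norm_eq_abs, abs_of_nonneg (hmin0 ω)]
    exact ciInf_le (Set.finite_range _).bddBelow j₀
  refine intervalIntegral_le_integral_of_le_measureReal_lt hmin (ae_of_all _ hmin0) hb hpint
    fun x hx => ⟨pow_nonneg (hp x hx).1 S, ?_⟩
  rw [measureReal_lt_iInf_eq_pow hc hlaw hind hf]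
  calc p x ^ S ≤ p x ^ Fintype.card κ :=
        pow_le_pow_of_le_one (hp x hx).1 ((hp x hx).2.trans measureReal_le_one) hS
    _ ≤ _ := pow_le_pow_left₀ (hp x hx).1 (hp x hx).2 _

end MinimumOfIndependentCopies

theorem ActionRegular.smoothedReg_le_integral_iInf {Ω : Type*} [MeasurableSpace Ω]
    {P : Measure Ω} [IsProbabilityMeasure P] {d : ℕ} {ρ : Measure (Vec d)} {lamA σ : ℝ}
    (hρ : ActionRegular ρ lamA σ) {κ : Type*} [Fintype κ] [Nonempty κ] {S : ℕ}
    (hS : Fintype.card κ ≤ S) {c : κ → Ω → Vec d} (hc : ∀ j, Measurable (c j))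
    (hlaw : ∀ j, P.map (c j) = ρ) (hind : iIndepFun c P) {w : Vec d} (hw : ‖w‖ = 1) :
    smoothedReg lamA σ S ≤ ∫ ω, ⨅ j, ⟪w, c j ω⟫ ^ 2 ∂P := by
  have hmean : 0 < ∫ a, ⟪w, a⟫ ^ 2 ∂ρ := hρ.lamA_pos.trans_le (hρ.le_integral_inner_sq hw)
  exact intervalIntegral_pow_le_integral_iInf hc hlaw hind (f := fun a => ⟪w, a⟫ ^ 2)
    (by fun_prop) (fun a => sq_nonneg _) (Integrable.of_integral_ne_zero hmean.ne')
    hρ.lamA_pos.le hS (intervalIntegrable_smoothedReg lamA σ S _ _)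
    fun x hx => ⟨(one_sub_exp_neg_mem_Icc lamA σ x).1, hρ.le_measureReal_lt_inner_sq hw hx.2⟩

section NetArgument

variable {E : Type*} [NormedAddCommGroup E] [InnerProductSpace ℝ E] {ι : Type*} [Fintype ι]
  {a : ι → E}

theorem sqrt_sum_inner_sq_le_add (a : ι → E) (v w : E) :
    √(∑ i, ⟪w, a i⟫ ^ 2) ≤ √(∑ i, ⟪v, a i⟫ ^ 2) + √(∑ i, ⟪v - w, a i⟫ ^ 2) := by
  let T : E → EuclideanSpace ℝ ι := fun v => WithLp.toLp 2 fun i => ⟪v, a i⟫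
  have hT : ∀ v, ‖T v‖ = √(∑ i, ⟪v, a i⟫ ^ 2) := fun v => by
    rw [EuclideanSpace.norm_eq]
    simp only [T, Real.norm_eq_abs, sq_abs]
  have hsub : T v - T w = T (v - w) := by
    ext i
    simp only [T, PiLp.sub_apply, inner_sub_left]
  rw [← hT, ← hT, ← hT, ← hsub, norm_sub_rev]
  exact norm_le_norm_add_norm_sub' (T w) (T v)

theorem sum_inner_sq_le_card_mul_norm_sq (ha : ∀ i, ‖a i‖ ≤ 1) (v : E) :
    ∑ i, ⟪v, a i⟫ ^ 2 ≤ Fintype.card ι * ‖v‖ ^ 2 := by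
  have h : ∀ i, ⟪v, a i⟫ ^ 2 ≤ ‖v‖ ^ 2 := fun i => by
    rw [← sq_abs]
    gcongr
    exact (abs_real_inner_le_norm _ _).trans (mul_le_of_le_one_right (norm_nonneg _) (ha i))
  simpa using Finset.sum_le_card_nsmul Finset.univ _ _ fun i _ => h i

theorem mul_norm_sq_le_sum_inner_sq_of_unit {m : ℝ}
    (h : ∀ v : E, ‖v‖ = 1 → m ≤ ∑ i, ⟪v, a i⟫ ^ 2) (v : E) :
    m * ‖v‖ ^ 2 ≤ ∑ i, ⟪v, a i⟫ ^ 2 := by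
  rcases eq_or_ne v 0 with rfl | hv
  · simp
  · have : ‖v‖ ≠ 0 := norm_ne_zero_iff.2 hv
    have hunit := h (‖v‖⁻¹ • v) (norm_smul_inv_norm hv)
    simp only [real_inner_smul_left, mul_pow, ← Finset.mul_sum] at hunit
    rwa [inv_pow, ← div_eq_inv_mul, le_div_iff₀ (by positivity)] at hunit

-- The constants fit because `3/4 - 1/24 = 17/24` and `(17/24)² = 289/576 ≥ 1/2`.
theorem half_mul_le_sum_inner_sq_of_near (ha : ∀ i, ‖a i‖ ≤ 1) {l : ℝ} (hl : 0 ≤ l) {v w : E}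
    (hvw : ‖v - w‖ ≤ √l / 24) (hw : 9 / 16 * l * Fintype.card ι ≤ ∑ i, ⟪w, a i⟫ ^ 2) :
    l * Fintype.card ι / 2 ≤ ∑ i, ⟪v, a i⟫ ^ 2 := by
  set r := √(l * Fintype.card ι)
  have hr2 : r ^ 2 = l * Fintype.card ι := Real.sq_sqrt (by positivity)
  have : 0 ≤ r := Real.sqrt_nonneg _
  have hclose : √(∑ i, ⟪v - w, a i⟫ ^ 2) ≤ r / 24 := by
    refine Real.sqrt_le_iff.2 ⟨by positivity, ?_⟩
    calc _ ≤ Fintype.card ι * ‖v - w‖ ^ 2 := sum_inner_sq_le_card_mul_norm_sq ha _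
      _ ≤ Fintype.card ι * (√l / 24) ^ 2 := by gcongr
      _ = (r / 24) ^ 2 := by rw [div_pow, div_pow, hr2, Real.sq_sqrt hl]; ring
  have hfar : 3 / 4 * r ≤ √(∑ i, ⟪w, a i⟫ ^ 2) := by
    refine Real.le_sqrt_of_sq_le ?_
    rw [mul_pow, hr2]
    linarith
  have hv : 17 / 24 * r ≤ √(∑ i, ⟪v, a i⟫ ^ 2) := by
    linarith [sqrt_sum_inner_sq_le_add a v w]
  have hsq := pow_le_pow_left₀ (by positivity) hv 2
  rw [mul_pow, hr2, Real.sq_sqrt (by positivity)] at hsq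
  have hl0 : 0 ≤ l * Fintype.card ι := by positivity
  linarith

theorem half_mul_norm_sq_le_sum_inner_sq_of_net (ha : ∀ i, ‖a i‖ ≤ 1) {l : ℝ} (hl : 0 ≤ l)
    {s : Finset E} (hnet : ∀ v ∈ Metric.sphere (0 : E) 1, ∃ w ∈ s, ‖v - w‖ ≤ √l / 24)
    (hs : ∀ w ∈ s, 9 / 16 * l * Fintype.card ι ≤ ∑ i, ⟪w, a i⟫ ^ 2) (v : E) :
    l * Fintype.card ι / 2 * ‖v‖ ^ 2 ≤ ∑ i, ⟪v, a i⟫ ^ 2 := by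
  refine mul_norm_sq_le_sum_inner_sq_of_unit (fun v hv => ?_) v
  obtain ⟨w, hws, hvw⟩ := hnet v (mem_sphere_zero_iff_norm.2 hv)
  exact half_mul_le_sum_inner_sq_of_near ha hl hvw (hs w hws)

end NetArgument

section NetCardinality

theorem exp_neg_mul_le_exp_neg_pow {d : ℕ} {l L N : ℝ} (hl : 0 < l) (hdl : d * l ≤ 1)
    (hL : 0 ≤ L) (hN : 16 / l ^ 2 * L ≤ N) :
    Real.exp (-(7 / 64 * l * N)) ≤ Real.exp (-(7 / 4 * L)) ^ d := by
  rw [← Real.exp_nat_mul]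
  refine Real.exp_le_exp.2 ?_
  have hd : (d : ℝ) ≤ 1 / l := by rwa [le_div_iff₀ hl]
  have h : d * (7 / 4 * L) ≤ 7 / 64 * l * N :=
    calc d * (7 / 4 * L) ≤ 1 / l * (7 / 4 * L) := by gcongr
      _ = 7 / 64 * l * (16 / l ^ 2 * L) := by
          field_simp
          ring
      _ ≤ 7 / 64 * l * N := by gcongr
  linarith

theorem div_sqrt_mul_exp_neg_log_le {l x B : ℝ} (hl : 0 < l) (hl1 : l ≤ 1) (hx : 0 < x)
    (hx1 : x ≤ 1 / 2) (hB : 8 / (l ^ 2 * x) ≤ B) :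
    49 / √l * Real.exp (-(7 / 4 * Real.log B)) ≤ x := by
  have hB0 : 0 < B := lt_of_lt_of_le (by positivity) hB
  have hBinv : B⁻¹ ≤ l ^ 2 * x / 8 := by
    rw [← inv_div]
    gcongr
  have hsqrt : √l ^ 4 = l ^ 2 := by
    rw [show 4 = 2 * 2 from rfl, pow_mul, Real.sq_sqrt hl.le]
  have hexp : Real.exp (-(7 / 4 * Real.log B)) ^ 4 = B⁻¹ ^ 7 := by
    rw [← Real.exp_nat_mul, ← Real.exp_log (pow_pos (inv_pos.2 hB0) 7), Real.log_pow,
      Real.log_inv]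
    congr 1
    push_cast
    ring
  refine le_of_pow_le_pow_left₀ (n := 4) (by norm_num) hx.le ?_
  rw [mul_pow, div_pow, hsqrt, hexp]
  calc 49 ^ 4 / l ^ 2 * B⁻¹ ^ 7 ≤ 49 ^ 4 / l ^ 2 * (l ^ 2 * x / 8) ^ 7 := by gcongr
    _ = 49 ^ 4 / 8 ^ 7 * (l ^ 12 * (x ^ 3 * x ^ 4)) := by
        field_simp
    _ ≤ 49 ^ 4 / 8 ^ 7 * (1 * ((1 / 2) ^ 3 * x ^ 4)) := by
        gcongr
        exact pow_le_one₀ hl.le hl1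
    _ ≤ x ^ 4 := by linarith [pow_pos hx 4]

theorem net_card_mul_exp_le {d : ℕ} {l x N : ℝ} (hd : 0 < d) (hl : 0 < l) (hdl : d * l ≤ 1)
    (hx : 0 < x) (hx1 : x ≤ 1 / 2) (hN : 16 / l ^ 2 * Real.log (8 * d / (l ^ 2 * x)) ≤ N) :
    (1 + 2 / (√l / 24)) ^ d * Real.exp (-(7 / 64 * l * N)) ≤ x := by
  have hd1 : (1 : ℝ) ≤ d := by exact_mod_cast hd
  have hl1 : l ≤ 1 := by nlinarith
  set B := 8 * d / (l ^ 2 * x)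
  have hB : 8 / (l ^ 2 * x) ≤ B := by
    simp only [B]
    gcongr
    linarith
  have hB1 : 1 ≤ B := by
    refine le_trans ?_ hB
    rw [one_le_div (by positivity)]
    nlinarith [pow_le_one₀ hl.le hl1 (n := 2)]
  have hnet : 1 + 2 / (√l / 24) ≤ 49 / √l := by
    have hs : 0 < √l := Real.sqrt_pos.2 hl
    rw [le_div_iff₀ hs]
    have : (1 + 2 / (√l / 24)) * √l = √l + 48 := by
      field_simp
      ring
    linarith [Real.sqrt_le_one.2 hl1]
  calc _ ≤ (49 / √l) ^ d * Real.exp (-(7 / 4 * Real.log B)) ^ d := by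
        gcongr
        exact exp_neg_mul_le_exp_neg_pow hl hdl (Real.log_nonneg hB1) hN
    _ = (49 / √l * Real.exp (-(7 / 4 * Real.log B))) ^ d := (mul_pow _ _ _).symm
    _ ≤ x ^ d := by
        gcongr
        exact div_sqrt_mul_exp_neg_log_le hl hl1 hx hx1 hB
    _ ≤ x := pow_le_of_le_one hx.le (by linarith) hd.ne'

end NetCardinality

section Dataset

namespace Dataset

variable {U d J : ℕ} (D : Dataset U d) {lam lt δ α γ : ℝ} {V : Finset (Fin U)} {θ : Vec d}

/-- The noise `∑ (r - ⟨θ, a⟩) a` of the pooled moment vector around its mean under `θ`. -/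
noncomputable def noise (θ : Vec d) (V : Finset (Fin U)) : Fin d → ℝ :=
  ∑ v ∈ V, ∑ i : Fin (D.N v), (D.rew v i - ⟪θ, D.act v i⟫) • (D.act v i).ofLp

theorem gram_eq_smul_one_add_gram_zero (lam : ℝ) (V : Finset (Fin U)) :
    D.gram lam V = lam • (1 : Matrix (Fin d) (Fin d) ℝ) + D.gram 0 V := by
  simp only [gram, zero_smul, zero_add]

theorem gram_zero_mulVec (V : Finset (Fin U)) (x : Vec d) :
    D.gram 0 V *ᵥ x.ofLp = ∑ v ∈ V, ∑ i, ⟪x, D.act v i⟫ • (D.act v i).ofLp := by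
  simp only [gram, zero_smul, zero_add, Matrix.sum_mulVec, Matrix.vecMulVec_mulVec,
    dotProduct_ofLp, real_inner_comm, op_smul_eq_smul]

theorem dotProduct_gram_zero_mulVec (V : Finset (Fin U)) (x : Vec d) :
    x.ofLp ⬝ᵥ (D.gram 0 V *ᵥ x.ofLp) = ∑ v ∈ V, ∑ i, ⟪x, D.act v i⟫ ^ 2 := by
  simp only [gram_zero_mulVec, dotProduct_sum, dotProduct_smul, dotProduct_ofLp, smul_eq_mul, sq]

theorem dotProduct_gram_mulVec (lam : ℝ) (V : Finset (Fin U)) (x : Vec d) :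
    x.ofLp ⬝ᵥ (D.gram lam V *ᵥ x.ofLp) = lam * ‖x‖ ^ 2
      + ∑ v ∈ V, ∑ i, ⟪x, D.act v i⟫ ^ 2 := by
  rw [gram_eq_smul_one_add_gram_zero, Matrix.add_mulVec, dotProduct_add,
    dotProduct_gram_zero_mulVec, Matrix.smul_mulVec, Matrix.one_mulVec, dotProduct_smul,
    dotProduct_ofLp_self, smul_eq_mul]

theorem gram_zero_posSemidef (V : Finset (Fin U)) : (D.gram 0 V).PosSemidef := by
  simp only [gram, zero_smul, zero_add]
  refine Matrix.posSemidef_sum _ fun v _ => Matrix.posSemidef_sum _ fun i _ => ?_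
  simpa using Matrix.posSemidef_vecMulVec_self_star (D.act v i).ofLp

theorem gram_posDef (hlam : 0 < lam) (V : Finset (Fin U)) : (D.gram lam V).PosDef := by
  rw [gram_eq_smul_one_add_gram_zero]
  exact posDef_smul_one_add hlam (D.gram_zero_posSemidef V)

theorem trace_gram_zero_le (hact : ∀ v i, ‖D.act v i‖ ≤ 1) (V : Finset (Fin U)) :
    (D.gram 0 V).trace ≤ sampleCount D.N V := by
  simp only [gram, zero_smul, zero_add, Matrix.trace_sum, Matrix.trace_vecMulVec,
    dotProduct_ofLp_self, sampleCount, Nat.cast_sum]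
  gcongr with v
  calc ∑ i, ‖D.act v i‖ ^ 2 ≤ ∑ _i : Fin (D.N v), (1 : ℝ) :=
        Finset.sum_le_sum fun i _ => pow_le_one₀ (norm_nonneg _) (hact v i)
    _ = D.N v := by simp

theorem ridge_sub_eq_gram_inv_mulVec (hlam : 0 < lam) (θ : Vec d) (V : Finset (Fin U)) :
    (D.ridge lam V - θ).ofLp = (D.gram lam V)⁻¹ *ᵥ (D.noise θ V - lam • θ.ofLp) := by
  have hmoment : D.moment V = D.noise θ V + D.gram 0 V *ᵥ θ.ofLp := by
    simp only [moment, noise, gram_zero_mulVec, sub_smul, Finset.sum_sub_distrib, sub_add_cancel]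
  have hgram : D.gram lam V *ᵥ θ.ofLp = lam • θ.ofLp + D.gram 0 V *ᵥ θ.ofLp := by
    rw [gram_eq_smul_one_add_gram_zero, Matrix.add_mulVec, Matrix.smul_mulVec, Matrix.one_mulVec]
  calc (D.ridge lam V - θ).ofLp
      = (D.gram lam V)⁻¹ *ᵥ D.moment V - (D.gram lam V)⁻¹ *ᵥ (D.gram lam V *ᵥ θ.ofLp) := by
        rw [inv_mulVec_mulVec (D.gram_posDef hlam V)]
        rfl
    _ = (D.gram lam V)⁻¹ *ᵥ (D.noise θ V - lam • θ.ofLp) := by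
        rw [hmoment, hgram, ← Matrix.mulVec_sub, add_sub_add_right_eq_sub]

theorem sqrt_mul_norm_le_weightedNorm_gram (lam : ℝ) (V : Finset (Fin U)) (x : Vec d) :
    √lam * ‖x‖ ≤ weightedNorm (D.gram lam V) x.ofLp := by
  rw [weightedNorm, ← Real.sqrt_sq (norm_nonneg x), ← Real.sqrt_mul' _ (sq_nonneg _),
    dotProduct_gram_mulVec]
  exact Real.sqrt_le_sqrt (le_add_of_nonneg_right (by positivity))

theorem weightedNorm_ridge_sub_le (hlam : 0 < lam) (hθ : ‖θ‖ ≤ 1) (V : Finset (Fin U)) :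
    weightedNorm (D.gram lam V) (D.ridge lam V - θ).ofLp
      ≤ weightedNorm (D.gram lam V)⁻¹ (D.noise θ V) + √lam := by
  have hM := D.gram_posDef hlam V
  have hbias : weightedNorm (D.gram lam V)⁻¹ (lam • θ.ofLp) ≤ √lam := by
    calc weightedNorm (D.gram lam V)⁻¹ (lam • θ).ofLp
        ≤ ‖lam • θ‖ / √lam := weightedNorm_inv_le hM (Real.sqrt_pos.2 hlam)
          (D.sqrt_mul_norm_le_weightedNorm_gram lam V) _
      _ ≤ lam / √lam := by
          rw [norm_smul, Real.norm_of_nonneg hlam.le]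
          gcongr
          exact mul_le_of_le_one_right hlam.le hθ
      _ = √lam := Real.div_sqrt
  rw [ridge_sub_eq_gram_inv_mulVec D hlam, weightedNorm_inv_mulVec hM]
  exact (weightedNorm_sub_le hM.inv.posSemidef _ _).trans (by gcongr)

/-- The confidence ellipsoid of the pooled ridge regression on `V` contains `θ`. -/
def CoversParameter (lam δ : ℝ) (V : Finset (Fin U)) (θ : Vec d) : Prop :=
  weightedNorm (D.gram lam V) (D.ridge lam V - θ).ofLp
    ≤ confRadius U d lam δ (sampleCount D.N V)

/-- The actions of every user excite all directions: the smallest eigenvalue of the unregularized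
Gram matrix of `u` is at least `λ̃ N_u / 2`, where `lt` stands for `λ̃`. -/
def Exciting (lt : ℝ) : Prop :=
  ∀ u, ∀ v : Vec d, lt * D.N u / 2 * ‖v‖ ^ 2 ≤ ∑ i, ⟪v, D.act u i⟫ ^ 2

variable {D}

theorem Exciting.sqrt_mul_norm_le_weightedNorm_gram (hD : D.Exciting lt) (lam : ℝ)
    (V : Finset (Fin U)) (x : Vec d) :
    √(lam + lt * sampleCount D.N V / 2) * ‖x‖ ≤ weightedNorm (D.gram lam V) x.ofLp := by
  rw [weightedNorm, ← Real.sqrt_sq (norm_nonneg x), ← Real.sqrt_mul' _ (sq_nonneg _),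
    dotProduct_gram_mulVec, add_mul, sampleCount, Nat.cast_sum,
    Finset.mul_sum, Finset.sum_div, Finset.sum_mul]
  gcongr
  exact hD _ x

section Clustering

theorem norm_ridge_singleton_sub_le (hD : D.Exciting lt) (hlam : 0 < lam) (hlt : 0 < lt)
    {u : Fin U} (hN : 0 < D.N u) (hθ : D.CoversParameter lam δ {u} θ) :
    ‖D.ridge lam {u} - θ‖ ≤ D.CI lam lt δ u := by
  have hcover := (hD.sqrt_mul_norm_le_weightedNorm_gram lam {u} _).trans hθ
  simp only [sampleCount, Finset.sum_singleton] at hcover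
  have : (0 : ℝ) < D.N u := by exact_mod_cast hN
  calc ‖D.ridge lam {u} - θ‖ ≤ confRadius U d lam δ (D.N u) / √(lam + lt * D.N u / 2) :=
        (le_div_iff₀' (by positivity)).2 hcover
    _ ≤ confRadius U d lam δ (D.N u) / √(lt * D.N u / 2) := by
        gcongr
        · unfold confRadius
          positivity
        · linarith

theorem graph_adj_iff {θ : Fin U → Vec d} {cl : Fin U → Fin J}
    (hcl : ∀ u v, cl u = cl v → θ u = θ v) (hgap : ∀ u v, cl u ≠ cl v → γ ≤ ‖θ u - θ v‖)
    (hest : ∀ u, ‖D.ridge lam {u} - θ u‖ ≤ D.CI lam lt δ u)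
    (hCI : ∀ u, D.CI lam lt δ u < γ / 4) (u v : Fin U) :
    (D.graph 1 lam lt δ).Adj u v ↔ u ≠ v ∧ cl u = cl v := by
  change (u ≠ v ∧ ¬ _) ↔ _
  rw [gt_iff_lt, one_mul, not_lt]
  refine and_congr_right fun _ => ⟨fun hclose => ?_, fun hsame => ?_⟩
  · by_contra hne
    have htriangle : ‖θ u - θ v‖ ≤ ‖D.ridge lam {u} - θ u‖
        + (‖D.ridge lam {u} - D.ridge lam {v}‖ + ‖D.ridge lam {v} - θ v‖) := by
      rw [norm_sub_rev (D.ridge lam {u}) (θ u)]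
      exact (norm_sub_le_norm_sub_add_norm_sub _ _ _).trans
        (add_le_add_right (norm_sub_le_norm_sub_add_norm_sub _ _ _) _)
    linarith [hgap u v hne, hest u, hest v, hCI u, hCI v]
  · calc ‖D.ridge lam {u} - D.ridge lam {v}‖
        ≤ ‖D.ridge lam {u} - θ u‖ + ‖D.ridge lam {v} - θ v‖ := by
          rw [← hcl u v hsame, norm_sub_rev (D.ridge lam {v})]
          exact norm_sub_le_norm_sub_add_norm_sub _ _ _
      _ ≤ D.CI lam lt δ u + D.CI lam lt δ v := add_le_add (hest u) (hest v)

theorem supp_connectedComponentMk_of_adj_iff {ι κ : Type*} {G : SimpleGraph ι} {c : ι → κ}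
    (h : ∀ u v, G.Adj u v ↔ u ≠ v ∧ c u = c v) (u : ι) :
    (G.connectedComponentMk u).supp = {v | c v = c u} := by
  ext v
  rw [SimpleGraph.ConnectedComponent.mem_supp_iff, SimpleGraph.ConnectedComponent.eq]
  constructor
  · rintro ⟨p⟩
    induction p with
    | nil => rfl
    | cons hadj _ ih => exact ((h _ _).1 hadj).2.trans ih
  · intro hv
    rcases eq_or_ne v u with rfl | huv
    · rfl
    · exact ((h v u).2 ⟨huv, hv⟩).reachable

theorem pool_eq_trueCluster_of_adj_iff {cl : Fin U → Fin J}
    (h : ∀ u v, (D.graph α lam lt δ).Adj u v ↔ u ≠ v ∧ cl u = cl v) (u : Fin U) :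
    D.pool α lam lt δ u = trueCluster cl u := by
  ext v
  simp only [pool, trueCluster, Finset.mem_filter, Finset.mem_univ, true_and, h]
  grind

theorem clustersCorrectly_of_adj_iff {cl : Fin U → Fin J}
    (h : ∀ u v, (D.graph α lam lt δ).Adj u v ↔ u ≠ v ∧ cl u = cl v) :
    D.ClustersCorrectly cl α lam lt δ := fun u =>
  ⟨supp_connectedComponentMk_of_adj_iff h u, by
    simp [pool_eq_trueCluster_of_adj_iff h, trueCluster]⟩

end Clustering

section Suboptimality

theorem CoversParameter.abs_inner_ridge_sub_le (hθ : D.CoversParameter lam δ V θ)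
    (hlam : 0 < lam) (b : Vec d) :
    |⟪D.ridge lam V - θ, b⟫|
      ≤ confRadius U d lam δ (sampleCount D.N V) * weightedNorm (D.gram lam V)⁻¹ b.ofLp := by
  have hM := D.gram_posDef hlam V
  have hle (c : Vec d) : ⟪D.ridge lam V - θ, c⟫
      ≤ confRadius U d lam δ (sampleCount D.N V) * weightedNorm (D.gram lam V)⁻¹ c.ofLp := by
    rw [← dotProduct_ofLp]
    exact (dotProduct_le_weightedNorm_mul_inv hM _ _).trans
      (mul_le_mul_of_nonneg_right hθ (weightedNorm_nonneg _ _))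
  have hneg : weightedNorm (D.gram lam V)⁻¹ (-b).ofLp = weightedNorm (D.gram lam V)⁻¹ b.ofLp := by
    simpa using weightedNorm_smul (D.gram lam V)⁻¹ (-1) b.ofLp
  refine abs_le'.2 ⟨hle b, ?_⟩
  rw [← inner_neg_right, ← hneg]
  exact hle (-b)

theorem pessimisticValue_le_inner {u : Fin U}
    (hθ : D.CoversParameter lam δ (D.pool α lam lt δ u) θ) (hlam : 0 < lam) (a : Vec d) :
    D.pessimisticValue α lam lt δ u a ≤ ⟪θ, a⟫ := by
  have herr := (abs_le.1 (hθ.abs_inner_ridge_sub_le hlam a)).2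
  rw [inner_sub_left, weightedNorm] at herr
  rw [pessimisticValue]
  linarith

theorem inner_sub_le_pessimisticValue {u : Fin U}
    (hθ : D.CoversParameter lam δ (D.pool α lam lt δ u) θ) (hlam : 0 < lam) (a : Vec d) :
    ⟪θ, a⟫ - 2 * (confRadius U d lam δ (sampleCount D.N (D.pool α lam lt δ u))
        * weightedNorm (D.gram lam (D.pool α lam lt δ u))⁻¹ a.ofLp)
      ≤ D.pessimisticValue α lam lt δ u a := by
  have herr := (abs_le.1 (hθ.abs_inner_ridge_sub_le hlam a)).1
  rw [inner_sub_left, weightedNorm] at herr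
  rw [pessimisticValue, weightedNorm]
  linarith

theorem subOpt_le (hD : D.Exciting lt) (hlam : 0 < lam) (hlt : 0 < lt) {u : Fin U}
    (hθ : D.CoversParameter lam δ (D.pool α lam lt δ u) θ) {A : Set (Vec d)} {a : Vec d}
    (hA : ∀ b ∈ A, ‖b‖ ≤ 1) (ha : D.IsOffCLUBAction α lam lt δ u A a) :
    subOpt θ A a ≤ 2 * confRadius U d lam δ (sampleCount D.N (D.pool α lam lt δ u))
      / √(lam + lt * sampleCount D.N (D.pool α lam lt δ u) / 2) := by
  rw [subOpt, sub_le_iff_le_add]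
  refine csSup_le (Set.Nonempty.image _ ⟨a, ha.1⟩) ?_
  rintro _ ⟨b, hb, rfl⟩
  set V := D.pool α lam lt δ u
  set m := lam + lt * sampleCount D.N V / 2
  set β := confRadius U d lam δ (sampleCount D.N V) with hβ
  have hβ0 : 0 ≤ β := by
    rw [hβ, confRadius]
    positivity
  have hwidth : β * weightedNorm (D.gram lam V)⁻¹ b.ofLp ≤ β * (1 / √m) := by
    gcongr
    refine (weightedNorm_inv_le (D.gram_posDef hlam V) (by positivity)
      (hD.sqrt_mul_norm_le_weightedNorm_gram lam V) b).trans ?_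
    gcongr
    exact hA b hb
  have hgap : ⟪θ, b⟫ - 2 * (β * weightedNorm (D.gram lam V)⁻¹ b.ofLp) ≤ ⟪θ, a⟫ :=
    (inner_sub_le_pessimisticValue hθ hlam b).trans
      ((ha.2 b hb).trans (pessimisticValue_le_inner hθ hlam a))
  calc ⟪θ, b⟫ ≤ 2 * (β * (1 / √m)) + ⟪θ, a⟫ := by linarith
    _ = 2 * β / √m + ⟪θ, a⟫ := by ring

end Suboptimality

end Dataset

end Dataset

section NoiseConcentration

namespace OfflineData

variable {Ω : Type*} [MeasurableSpace Ω] {P : Measure Ω} {U d : ℕ} {θ : Fin U → Vec d}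
  {ρ : Measure (Vec d)} {S : ℕ} (X : OfflineData P θ ρ S)

theorem ae_norm_cand_le (hρ : ∀ᵐ a ∂ρ, ‖a‖ ≤ 1) :
    ∀ᵐ ω ∂P, ∀ u i j, ‖X.cand u i j ω‖ ≤ 1 := by
  simp only [ae_all_iff]
  intro u i j
  rw [← X.cand_law u i j] at hρ
  exact ae_of_ae_map (X.cand_measurable u i j).aemeasurable hρ

theorem ae_exists_act_eq_cand : ∀ᵐ ω ∂P, ∀ u i, ∃ j, X.act u i ω = X.cand u i j ω := by
  simpa only [ae_all_iff] using X.act_mem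

theorem ae_norm_act_le (hρ : ∀ᵐ a ∂ρ, ‖a‖ ≤ 1) : ∀ᵐ ω ∂P, ∀ u i, ‖X.act u i ω‖ ≤ 1 := by
  filter_upwards [X.ae_norm_cand_le hρ, X.ae_exists_act_eq_cand] with ω hcand hact u i
  obtain ⟨j, hj⟩ := hact u i
  exact hj ▸ hcand u i j

theorem measurable_act (u : Fin U) (i : Fin (X.N u)) : Measurable (X.act u i) :=
  (X.act_measurable u i).mono (X.ℱ.le _) le_rfl

theorem measurable_reward_noise (p : (u : Fin U) × Fin (X.N u)) :
    Measurable[X.ℱ (X.time p + 1)] fun ω => X.rew p.1 p.2 ω - ⟪θ p.1, X.act p.1 p.2 ω⟫ := by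
  have hact : Measurable[X.ℱ (X.time p + 1)] (X.act p.1 p.2) :=
    (X.act_measurable p.1 p.2).mono (X.ℱ.mono (Nat.le_succ _)) le_rfl
  exact (X.rew_measurable p.1 p.2).sub ((measurable_const.inner measurable_id).comp hact)

theorem measurable_noise (θ₀ : Vec d) (V : Finset (Fin U)) :
    Measurable fun ω => (X.dataset ω).noise θ₀ V := by
  change Measurable fun ω => ∑ v ∈ V, ∑ i : Fin (X.N v),
    (X.rew v i ω - ⟪θ₀, X.act v i ω⟫) • (X.act v i ω).ofLp
  refine Finset.measurable_fun_sum _ fun v _ => Finset.measurable_fun_sum _ fun i _ => ?_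
  have hact := X.measurable_act v i
  have hrew : Measurable (X.rew v i) := (X.rew_measurable v i).mono (X.ℱ.le _) le_rfl
  exact (hrew.sub (measurable_const.inner hact)).smul
    ((PiLp.continuous_ofLp 2 _).measurable.comp hact)

theorem measurable_gram_apply (lam : ℝ) (V : Finset (Fin U)) (k l : Fin d) :
    Measurable fun ω => (X.dataset ω).gram lam V k l := by
  simp only [Dataset.gram, Matrix.add_apply, Matrix.sum_apply, Matrix.vecMulVec_apply]
  change Measurable fun ω => (lam • (1 : Matrix (Fin d) (Fin d) ℝ)) k l
    + ∑ v ∈ V, ∑ i : Fin (X.N v), (X.act v i ω).ofLp k * (X.act v i ω).ofLp l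
  refine measurable_const.add
    (Finset.measurable_fun_sum _ fun v _ => Finset.measurable_fun_sum _ fun i _ => ?_)
  have hcoord (k : Fin d) : Measurable fun ω => (X.act v i ω).ofLp k :=
    (measurable_pi_apply k).comp
      ((PiLp.continuous_ofLp 2 _).measurable.comp (X.measurable_act v i))
  exact (hcoord k).mul (hcoord l)

variable [IsProbabilityMeasure P]

theorem condExpLeOne_exp_reward_noise (x : Vec d) (p : (u : Fin U) × Fin (X.N u)) :
    CondExpLeOne (X.ℱ (X.time p)) P fun ω => ENNReal.ofReal
      (Real.exp (⟪x, X.act p.1 p.2 ω⟫ * (X.rew p.1 p.2 ω - ⟪θ p.1, X.act p.1 p.2 ω⟫))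
        / Real.exp (⟪x, X.act p.1 p.2 ω⟫ ^ 2 / 2)) := by
  have hnoise : Measurable fun ω => X.rew p.1 p.2 ω - ⟪θ p.1, X.act p.1 p.2 ω⟫ :=
    (X.measurable_reward_noise p).mono (X.ℱ.le _) le_rfl
  have hact : Measurable[X.ℱ (X.time p)] fun ω => ⟪x, X.act p.1 p.2 ω⟫ :=
    (measurable_const.inner measurable_id).comp (X.act_measurable p.1 p.2)
  refine CondExpLeOne.comp_stronglyMeasurable (X.ℱ.le _)
    (F := fun c ω => ENNReal.ofReal
      (Real.exp (c * (X.rew p.1 p.2 ω - ⟪θ p.1, X.act p.1 p.2 ω⟫)) / Real.exp (c ^ 2 / 2)))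
    (fun c => by fun_prop) (fun ω => ?_) (fun c => ?_) hact.stronglyMeasurable
  · exact ENNReal.continuous_ofReal.comp
      (Continuous.div (by fun_prop) (by fun_prop) fun c => (Real.exp_pos _).ne')
  · exact CondExpLeOne.of_condExp_le (X.ℱ.le _) (X.noise_integrable p.1 p.2 c)
      (ae_of_all _ fun ω => (Real.exp_pos _).le) (Real.exp_pos _) (X.noise_subgaussian p.1 p.2 c)

theorem lintegral_exp_noise_le_one {θ₀ : Vec d} {V : Finset (Fin U)} (hV : ∀ v ∈ V, θ v = θ₀)
    (x : Vec d) :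
    ∫⁻ ω, ENNReal.ofReal (Real.exp ((X.dataset ω).noise θ₀ V ⬝ᵥ x.ofLp
      - x.ofLp ⬝ᵥ ((X.dataset ω).gram 0 V *ᵥ x.ofLp) / 2)) ∂P ≤ 1 := by
  refine le_of_eq_of_le (lintegral_congr fun ω => ?_)
    (lintegral_prod_le_one X.time_injective (fun p => ?_) (X.condExpLeOne_exp_reward_noise x)
      (V.sigma fun _ => Finset.univ))
  · rw [← ENNReal.ofReal_prod_of_nonneg fun _ _ => by positivity]
    simp only [← Real.exp_sub]
    rw [← Real.exp_sum, Finset.sum_sigma, Dataset.dotProduct_gram_zero_mulVec, Dataset.noise,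
      sum_dotProduct, Finset.sum_div, ← Finset.sum_sub_distrib]
    congr 2
    refine Finset.sum_congr rfl fun v hv => ?_
    simp only [sum_dotProduct, smul_dotProduct, dotProduct_ofLp, Finset.sum_div,
      Finset.sum_sub_distrib, hV v hv, real_inner_comm x, smul_eq_mul, mul_comm, dataset]
    rfl
  · have hact : Measurable[X.ℱ (X.time p + 1)] fun ω => ⟪x, X.act p.1 p.2 ω⟫ :=
      (measurable_const.inner measurable_id).comp
        ((X.act_measurable p.1 p.2).mono (X.ℱ.mono (Nat.le_succ _)) le_rfl)
    exact ((hact.mul (X.measurable_reward_noise p)).exp.div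
      ((hact.pow_const 2).div_const 2).exp).ennreal_ofReal

theorem measure_not_coversParameter_le (hρ : ∀ᵐ a ∂ρ, ‖a‖ ≤ 1) {lam δ : ℝ} (hlam : 0 < lam)
    (hδ : 0 < δ) {u : Fin U} (hθ : ‖θ u‖ ≤ 1) {V : Finset (Fin U)} (hV : ∀ v ∈ V, θ v = θ u) :
    P {ω | ¬ (X.dataset ω).CoversParameter lam δ V (θ u)} ≤ ENNReal.ofReal (δ / (2 * U)) := by
  have hU : (0 : ℝ) < U := by exact_mod_cast u.pos
  refine le_trans (measure_mono_ae ?_) (measure_log_det_add_lt_weightedNorm_sq_le hlam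
    (X.measurable_noise (θ u) V) (X.measurable_gram_apply 0 V)
    (fun ω => (X.dataset ω).gram_zero_posSemidef V)
    (fun x => X.lintegral_exp_noise_le_one hV (WithLp.toLp 2 x))
    (ε := δ / (2 * U)) (by positivity))
  filter_upwards [X.ae_norm_act_le hρ] with ω hnorm hω
  change ¬ (X.dataset ω).CoversParameter lam δ V (θ u) at hω
  contrapose! hω
  change ¬ _ < _ at hω
  rw [not_lt, ← Dataset.gram_eq_smul_one_add_gram_zero, one_div_div] at hω
  have hlogdet : Real.log (((X.dataset ω).gram lam V).det / lam ^ Fintype.card (Fin d))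
      ≤ d * Real.log (1 + sampleCount X.N V / (lam * d)) := by
    have htrace : (0 : ℝ) ≤ ((X.dataset ω).gram 0 V).trace :=
      ((X.dataset ω).gram_zero_posSemidef V).trace_nonneg
    have hle := log_det_smul_one_add_div_le hlam ((X.dataset ω).gram_zero_posSemidef V)
    rw [Fintype.card_fin, ← Dataset.gram_eq_smul_one_add_gram_zero] at hle
    rw [Fintype.card_fin]
    refine hle.trans ?_
    gcongr
    exact (X.dataset ω).trace_gram_zero_le hnorm V
  calc weightedNorm ((X.dataset ω).gram lam V) ((X.dataset ω).ridge lam V - θ u).ofLp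
      ≤ weightedNorm ((X.dataset ω).gram lam V)⁻¹ ((X.dataset ω).noise (θ u) V) + √lam :=
        (X.dataset ω).weightedNorm_ridge_sub_le hlam hθ V
    _ ≤ confRadius U d lam δ (sampleCount X.N V) := by
        rw [confRadius]
        gcongr
        exact Real.le_sqrt_of_sq_le (hω.trans (by gcongr))

end OfflineData

end NoiseConcentration

section Excitation

namespace OfflineData

variable {Ω : Type*} [MeasurableSpace Ω] {P : Measure Ω} {U d : ℕ}
  {θ : Fin U → Vec d} {ρ : Measure (Vec d)} {S : ℕ} (X : OfflineData P θ ρ S) {lamA σ : ℝ}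

theorem sum_iInf_inner_sq_le_sum_inner_sq {u : Fin U} {ω : Ω}
    (hact : ∀ i, ∃ j, X.act u i ω = X.cand u i j ω) (w : Vec d) :
    ∑ i, ⨅ j, ⟪w, X.cand u i j ω⟫ ^ 2 ≤ ∑ i, ⟪w, X.act u i ω⟫ ^ 2 := by
  refine Finset.sum_le_sum fun i _ => ?_
  obtain ⟨j, hj⟩ := hact i
  rw [hj]
  exact ciInf_le (Set.finite_range _).bddBelow j

variable [IsProbabilityMeasure P]

theorem nonempty_fin_numCand (u : Fin U) (i : Fin (X.N u)) : Nonempty (Fin (X.numCand u i)) :=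
  let ⟨_, j, _⟩ := (X.act_mem u i).exists
  ⟨j⟩

theorem measureReal_sum_iInf_inner_sq_le (hρ : ActionRegular ρ lamA σ) (u : Fin U) {w : Vec d}
    (hw : ‖w‖ = 1) :
    P.real {ω | ∑ i, ⨅ j, ⟪w, X.cand u i j ω⟫ ^ 2 ≤ 9 / 16 * smoothedReg lamA σ S * X.N u}
      ≤ Real.exp (-(7 / 64 * smoothedReg lamA σ S * X.N u)) := by
  have := X.nonempty_fin_numCand u
  have hmin (i : Fin (X.N u)) :
      Measurable fun c : Fin (X.numCand u i) → Vec d => ⨅ j, ⟪w, c j⟫ ^ 2 :=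
    Measurable.iInf fun j => by fun_prop
  have hcand (i : Fin (X.N u)) : Measurable fun ω j => X.cand u i j ω :=
    measurable_pi_iff.2 (X.cand_measurable u i)
  have hmem (i : Fin (X.N u)) : ∀ᵐ ω ∂P, ⨅ j, ⟪w, X.cand u i j ω⟫ ^ 2 ∈ Set.Icc 0 1 := by
    filter_upwards [X.ae_norm_cand_le hρ.norm_le] with ω hω
    obtain ⟨j, hj⟩ := exists_eq_ciInf_of_finite (f := fun j => ⟪w, X.cand u i j ω⟫ ^ 2)
    have habs : |⟪w, X.cand u i j ω⟫| ≤ 1 := (abs_real_inner_le_norm _ _).trans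
      (by rw [hw, one_mul]; exact hω u i j)
    rw [← hj]
    exact ⟨sq_nonneg _, (sq_le_one_iff_abs_le_one _).2 habs⟩
  simpa using measureReal_sum_le_nine_sixteenths_le_exp
    ((iIndepFun_curry (X.cand_measurable u) (X.cand_indep u)).comp _ hmin)
    (fun i => (hmin i).comp (hcand i)) hmem (smoothedReg_pos hρ.lamA_pos hρ.sigma_pos S).le
    fun i => hρ.smoothedReg_le_integral_iInf (by simpa using X.numCand_le u i)
      (X.cand_measurable u i) (X.cand_law u i) (iIndepFun_block (X.cand_indep u) i) hw

theorem measure_not_half_mul_norm_sq_le_sum_inner_sq_le (hρ : ActionRegular ρ lamA σ) {x : ℝ}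
    (hx : 0 < x) (hx1 : x ≤ 1 / 2) {u : Fin U}
    (hN : 16 / smoothedReg lamA σ S ^ 2
      * Real.log (8 * d / (smoothedReg lamA σ S ^ 2 * x)) ≤ X.N u) :
    P {ω | ¬ ∀ v : Vec d, smoothedReg lamA σ S * X.N u / 2 * ‖v‖ ^ 2
      ≤ ∑ i, ⟪v, X.act u i ω⟫ ^ 2} ≤ ENNReal.ofReal x := by
  set l := smoothedReg lamA σ S
  have hl : 0 < l := smoothedReg_pos hρ.lamA_pos hρ.sigma_pos S
  obtain ⟨s, hs, hnet, hcard⟩ := exists_finset_net_card_le (E := Vec d) (ε := √l / 24)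
    (by positivity) Metric.sphere_subset_closedBall
  let bad (w : Vec d) : Set Ω := {ω | ∑ i, ⨅ j, ⟪w, X.cand u i j ω⟫ ^ 2 ≤ 9 / 16 * l * X.N u}
  have hbad (w : Vec d) (hw : w ∈ s) :
      P (bad w) ≤ ENNReal.ofReal (Real.exp (-(7 / 64 * l * X.N u))) := by
    rw [← ofReal_measureReal]
    exact ENNReal.ofReal_le_ofReal
      (X.measureReal_sum_iInf_inner_sq_le hρ u (mem_sphere_zero_iff_norm.1 (hs hw)))
  calc _ ≤ P (⋃ w ∈ s, bad w) := by
        refine measure_mono_ae ?_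
        filter_upwards [X.ae_exists_act_eq_cand, X.ae_norm_act_le hρ.norm_le]
          with ω hact hnorm hω
        by_contra hgood
        change ω ∉ ⋃ w ∈ s, bad w at hgood
        simp only [bad, Set.mem_iUnion, not_exists, Set.mem_ofPred_eq, not_le] at hgood
        refine hω fun v => ?_
        simpa using half_mul_norm_sq_le_sum_inner_sq_of_net (hnorm u) hl.le hnet
          (fun w hw => by
            simpa using (hgood w hw).le.trans (X.sum_iInf_inner_sq_le_sum_inner_sq (hact u) w)) v
    _ ≤ ∑ _w ∈ s, ENNReal.ofReal (Real.exp (-(7 / 64 * l * X.N u))) :=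
        (measure_biUnion_finset_le _ _).trans (Finset.sum_le_sum hbad)
    _ = ENNReal.ofReal (s.card * Real.exp (-(7 / 64 * l * X.N u))) := by
        rw [Finset.sum_const, nsmul_eq_mul, ENNReal.ofReal_mul (Nat.cast_nonneg _),
          ENNReal.ofReal_natCast]
    _ ≤ ENNReal.ofReal x := by
        refine ENNReal.ofReal_le_ofReal (le_trans ?_
          (net_card_mul_exp_le hρ.dim_pos hl (hρ.dim_mul_smoothedReg_le_one S) hx hx1 hN))
        gcongr
        simpa using hcard

end OfflineData

end Excitation

section ConfidenceWidth

theorem log_one_add_le_div_mul_log {x t : ℝ} (ht : 0 < t) (htx : t ≤ x) :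
    Real.log (1 + x) ≤ x / t * Real.log (1 + t) := by
  have hbernoulli := one_add_mul_self_le_rpow_one_add (s := t) (by linarith) (p := x / t)
    ((one_le_div ht).2 htx)
  rw [div_mul_cancel₀ _ ht.ne'] at hbernoulli
  rw [← Real.log_rpow (by linarith)]
  exact Real.log_le_log (by linarith) hbernoulli

theorem mul_log_one_add_div_le {T n c K : ℝ} (hT : 0 < T) (hTn : T ≤ n) (hc : 0 < c)
    (hK : Real.log (1 + T / c) ≤ K) : T * Real.log (1 + n / c) ≤ n * K := by
  have hn : 0 < n := hT.trans_le hTn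
  calc T * Real.log (1 + n / c) ≤ T * (n / c / (T / c) * Real.log (1 + T / c)) := by
        gcongr
        exact log_one_add_le_div_mul_log (by positivity) (by gcongr)
    _ = n * Real.log (1 + T / c) := by field_simp
    _ ≤ n * K := by gcongr

theorem log_one_add_le_log_div {x y δ : ℝ} (hx : 0 ≤ x) (hδ : 0 < δ) (h : δ ≤ y / (1 + x)) :
    Real.log (1 + x) ≤ Real.log (y / δ) :=
  Real.log_le_log (by positivity) ((le_div_comm₀ hδ (by positivity)).1 h)

theorem log_two_mul_div_pos {U : ℕ} {δ : ℝ} (hU : 0 < U) (hδ₀ : 0 < δ) (hδ₂ : δ < 2) :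
    0 < Real.log (2 * U / δ) := by
  have hU1 : (1 : ℝ) ≤ U := by exact_mod_cast hU
  exact Real.log_pos ((one_lt_div hδ₀).2 (by linarith))

variable {U d n : ℕ} {lam lt γ δ : ℝ}

theorem confRadius_le_two_mul_sqrt
    (hlam : lam ≤ d * Real.log (1 + n / (lam * d)) + 2 * Real.log (2 * U / δ)) :
    confRadius U d lam δ n
      ≤ 2 * √(d * Real.log (1 + n / (lam * d)) + 2 * Real.log (2 * U / δ)) := by
  rw [confRadius, two_mul √_]
  exact add_le_add_right (Real.sqrt_le_sqrt hlam) _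

theorem gapThreshold_pos (hd : 0 < d) (hlt : 0 < lt) (hγ : 0 < γ)
    (hK : 0 < Real.log (2 * U / δ)) : 0 < gapThreshold U d lt γ δ := by
  unfold gapThreshold
  positivity

theorem mul_log_add_log_lt_of_gapThreshold_le (hd : 0 < d) (hlam : 0 < lam) (hlt : 0 < lt)
    (hγ : 0 < γ) (hK : 0 < Real.log (2 * U / δ)) (hn : gapThreshold U d lt γ δ ≤ n)
    (hT : Real.log (1 + gapThreshold U d lt γ δ / (lam * d)) ≤ Real.log (2 * U / δ)) :
    8 ^ 2 * (d * Real.log (1 + n / (lam * d)) + 2 * Real.log (2 * U / δ))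
      < γ ^ 2 * (lt * n / 2) := by
  have hd1 : (1 : ℝ) ≤ d := by exact_mod_cast hd
  have hT0 := gapThreshold_pos hd hlt hγ hK
  have hTL := mul_log_one_add_div_le hT0 hn (by positivity) hT
  have hTdef : gapThreshold U d lt γ δ * (γ ^ 2 * lt) = 512 * d * Real.log (2 * U / δ) := by
    unfold gapThreshold
    field_simp
  have hn0 := hT0.trans_le hn
  set K := Real.log (2 * U / δ)
  set T := gapThreshold U d lt γ δ
  have hKd : n * K ≤ d * (n * K) := le_mul_of_one_le_left (by positivity) hd1
  have hdK : 0 < d * (n * K) := by positivity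
  refine lt_of_mul_lt_mul_left ?_ hT0.le
  calc T * (8 ^ 2 * (d * Real.log (1 + n / (lam * d)) + 2 * K))
      = 64 * d * (T * Real.log (1 + n / (lam * d))) + 128 * (T * K) := by ring
    _ ≤ 64 * d * (n * K) + 128 * (n * K) := by gcongr
    _ < 256 * d * (n * K) := by linarith
    _ = T * (γ ^ 2 * (lt * n / 2)) := by linear_combination -(n : ℝ) / 2 * hTdef

theorem confRadius_div_sqrt_lt (hlt : 0 < lt) (hγ : 0 < γ) (hn : 0 < n)
    (hlam : lam ≤ d * Real.log (1 + n / (lam * d)) + 2 * Real.log (2 * U / δ))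
    (h : 8 ^ 2 * (d * Real.log (1 + n / (lam * d)) + 2 * Real.log (2 * U / δ))
      < γ ^ 2 * (lt * n / 2)) :
    confRadius U d lam δ n / √(lt * n / 2) < γ / 4 := by
  have : (0 : ℝ) < n := by exact_mod_cast hn
  have hlt_sqrt : 8 * √(d * Real.log (1 + n / (lam * d)) + 2 * Real.log (2 * U / δ))
      < γ * √(lt * n / 2) := by
    rw [← Real.sqrt_sq (show (0 : ℝ) ≤ 8 by norm_num), ← Real.sqrt_mul (sq_nonneg _),
      ← Real.sqrt_sq hγ.le, ← Real.sqrt_mul (sq_nonneg _)]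
    refine Real.sqrt_lt_sqrt_iff_of_pos (by positivity) |>.2 ?_
    simpa only [Real.sqrt_sq hγ.le, Real.sqrt_sq (show (0 : ℝ) ≤ 8 by norm_num)] using h
  rw [div_lt_iff₀ (Real.sqrt_pos.2 (by positivity))]
  linarith [confRadius_le_two_mul_sqrt hlam]

theorem two_mul_confRadius_div_le (hd : 0 < d) (hlam : 0 < lam) (hlt : 0 < lt) (hn : 0 < n)
    (hK : 0 ≤ Real.log (2 * U / δ))
    (hlam_le : lam ≤ d * Real.log (1 + n / (lam * d)) + 2 * Real.log (2 * U / δ)) :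
    2 * confRadius U d lam δ n / √(lam + lt * n / 2)
      ≤ 8 * √(d / (lt * n)) * √(Real.log (1 + n / (lam * d)) + Real.log (2 * U / δ)) := by
  have hd1 : (1 : ℝ) ≤ d := by exact_mod_cast hd
  have : (0 : ℝ) < n := by exact_mod_cast hn
  have hradius := confRadius_le_two_mul_sqrt hlam_le
  set K := Real.log (2 * U / δ)
  set L := Real.log (1 + n / (lam * d))
  have hsqrt : √(d * L + 2 * K) ≤ √2 * (√d * √(L + K)) := by
    have hL : 0 ≤ L := Real.log_nonneg (le_add_of_nonneg_right (by positivity))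
    rw [← Real.sqrt_mul (by positivity), ← Real.sqrt_mul (by positivity)]
    refine Real.sqrt_le_sqrt ?_
    nlinarith [mul_le_mul_of_nonneg_right hd1 hK, mul_nonneg (Nat.cast_nonneg d) hL]
  calc 2 * confRadius U d lam δ n / √(lam + lt * n / 2)
      ≤ 2 * (2 * (√2 * (√d * √(L + K)))) / √(lt * n / 2) := by
        gcongr
        · linarith
        · linarith
    _ = 8 * √(d / (lt * n)) * √(L + K) := by
        rw [Real.sqrt_div (by positivity), Real.sqrt_div (by positivity), div_div_eq_mul_div]
        ring_nf
        rw [Real.sq_sqrt (by norm_num)]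
        ring

end ConfidenceWidth

section UnionBound

variable {Ω : Type*} [MeasurableSpace Ω] {P : Measure Ω}

theorem exists_measurableSet_forall_of_measure_not_le [IsProbabilityMeasure P] {p : Ω → Prop}
    {ε : ℝ} (hε : 0 ≤ ε) (hp : P {ω | ¬ p ω} ≤ ENNReal.ofReal ε) :
    ∃ E : Set Ω, MeasurableSet E ∧ 1 - ε ≤ P.real E ∧ ∀ ω ∈ E, p ω := by
  have hmeas := measurableSet_toMeasurable P {ω | ¬ p ω}
  refine ⟨_, hmeas.compl, ?_, fun ω hω => by_contra fun hnot => hω (subset_toMeasurable _ _ hnot)⟩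
  rw [probReal_compl_eq_one_sub hmeas, measureReal_def, measure_toMeasurable]
  exact sub_le_sub_left (ENNReal.toReal_le_of_le_ofReal hε hp) 1

theorem measure_not_forall_le_of_le_div {U : ℕ} {p : Fin U → Ω → Prop} {ε : ℝ} (hε : 0 ≤ ε)
    (hp : ∀ u, P {ω | ¬ p u ω} ≤ ENNReal.ofReal (ε / U)) :
    P {ω | ¬ ∀ u, p u ω} ≤ ENNReal.ofReal ε := by
  calc P {ω | ¬ ∀ u, p u ω} = P (⋃ u, {ω | ¬ p u ω}) := by
        congr 1
        ext ω
        simp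
    _ ≤ ∑ u, P {ω | ¬ p u ω} := measure_iUnion_fintype_le _ _
    _ ≤ ∑ _u : Fin U, ENNReal.ofReal (ε / U) := Finset.sum_le_sum fun u _ => hp u
    _ = ENNReal.ofReal (U * (ε / U)) := by
        rw [Finset.sum_const, Finset.card_univ, Fintype.card_fin, nsmul_eq_mul,
          ENNReal.ofReal_mul (Nat.cast_nonneg _), ENNReal.ofReal_natCast]
    _ ≤ ENNReal.ofReal ε := by
        rw [mul_div_left_comm]
        exact ENNReal.ofReal_le_ofReal (mul_le_of_le_one_right hε (div_self_le_one _))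

end UnionBound

section GoodEvent

theorem mem_trueCluster {U J : ℕ} {cl : Fin U → Fin J} {u v : Fin U} :
    v ∈ trueCluster cl u ↔ cl v = cl u := by
  simp only [trueCluster, Finset.mem_filter, Finset.mem_univ, true_and]

theorem le_sampleCount_trueCluster {U J : ℕ} (N : Fin U → ℕ) (cl : Fin U → Fin J) (u : Fin U) :
    N u ≤ sampleCount N (trueCluster cl u) :=
  Finset.single_le_sum (f := N) (fun _ _ => Nat.zero_le _) (mem_trueCluster.2 rfl)

/-- The event on which Off-CLUB succeeds: all users have exciting actions, and the confidence
ellipsoids of all single users and of all true clusters contain the preference vectors. -/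
structure Dataset.IsGood {U d J : ℕ} (D : Dataset U d) (θ : Fin U → Vec d) (cl : Fin U → Fin J)
    (lam lt δ : ℝ) : Prop where
  exciting : D.Exciting lt
  covers_singleton : ∀ u, D.CoversParameter lam δ {u} (θ u)
  covers_trueCluster : ∀ u, D.CoversParameter lam δ (trueCluster cl u) (θ u)

theorem OfflineData.measure_not_isGood_le {Ω : Type*} [MeasurableSpace Ω] {P : Measure Ω}
    [IsProbabilityMeasure P] {U d J S : ℕ} {θ : Fin U → Vec d} {ρ : Measure (Vec d)}
    (X : OfflineData P θ ρ S) {lamA σ lam δ : ℝ} {cl : Fin U → Fin J}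
    (hρ : ActionRegular ρ lamA σ) (hθ : ∀ u, ‖θ u‖ ≤ 1) (hcl : ∀ u v, cl u = cl v → θ u = θ v)
    (hδ₀ : 0 < δ) (hδ₁ : δ ≤ 1 / 2) (hlam : 0 < lam)
    (hN : ∀ u, 16 / smoothedReg lamA σ S ^ 2
      * Real.log (8 * d * U / (smoothedReg lamA σ S ^ 2 * δ)) ≤ X.N u) :
    P {ω | ¬ (X.dataset ω).IsGood θ cl lam (smoothedReg lamA σ S) δ}
      ≤ ENNReal.ofReal (2 * δ) := by
  have hexc : P {ω | ¬ (X.dataset ω).Exciting (smoothedReg lamA σ S)} ≤ ENNReal.ofReal δ := by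
    refine measure_not_forall_le_of_le_div hδ₀.le fun u => ?_
    have hU : (1 : ℝ) ≤ U := by exact_mod_cast u.pos
    refine X.measure_not_half_mul_norm_sq_le_sum_inner_sq_le hρ (by positivity)
      ((div_le_self hδ₀.le hU).trans hδ₁) ((hN u).trans_eq' ?_)
    rw [← mul_div_assoc, div_div_eq_mul_div]
  have hcover (V : Fin U → Finset (Fin U)) (hV : ∀ u, ∀ v ∈ V u, θ v = θ u) :
      P {ω | ¬ ∀ u, (X.dataset ω).CoversParameter lam δ (V u) (θ u)}
        ≤ ENNReal.ofReal (δ / 2) :=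
    measure_not_forall_le_of_le_div (by positivity) fun u => by
      rw [div_div]
      exact X.measure_not_coversParameter_le hρ.norm_le hlam hδ₀ (hθ u) (hV u)
  have hsingle := hcover (fun u => {u}) fun u v hv => by rw [Finset.mem_singleton.1 hv]
  have hcluster := hcover (trueCluster cl) fun u v hv => hcl v u (mem_trueCluster.1 hv)
  calc _ ≤ P ({ω | ¬ (X.dataset ω).Exciting (smoothedReg lamA σ S)}
          ∪ ({ω | ¬ ∀ u, (X.dataset ω).CoversParameter lam δ {u} (θ u)}
            ∪ {ω | ¬ ∀ u, (X.dataset ω).CoversParameter lam δ (trueCluster cl u) (θ u)})) := by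
        refine measure_mono fun ω hω => ?_
        by_contra hbad
        simp only [Set.mem_union, Set.mem_ofPred_eq, not_or, not_not] at hbad
        exact hω ⟨hbad.1, hbad.2.1, hbad.2.2⟩
    _ ≤ ENNReal.ofReal δ + (ENNReal.ofReal (δ / 2) + ENNReal.ofReal (δ / 2)) :=
        (measure_union_le _ _).trans
          (add_le_add hexc ((measure_union_le _ _).trans (add_le_add hsingle hcluster)))
    _ = ENNReal.ofReal (2 * δ) := by
        rw [← ENNReal.ofReal_add (by positivity) (by positivity), add_halves,
          ← ENNReal.ofReal_add hδ₀.le hδ₀.le, two_mul]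

namespace Dataset.IsGood

variable {U d J : ℕ} {D : Dataset U d} {θ : Fin U → Vec d} {cl : Fin U → Fin J}
  {lam lt δ γ : ℝ}

theorem graph_adj_iff (h : D.IsGood θ cl lam lt δ) (hcl : ∀ u v, cl u = cl v → θ u = θ v)
    (hgap : ∀ u v, cl u ≠ cl v → γ ≤ ‖θ u - θ v‖) (hlam : 0 < lam) (hlt : 0 < lt)
    (hN : ∀ u, 0 < D.N u) (hCI : ∀ u, D.CI lam lt δ u < γ / 4) (u v : Fin U) :
    (D.graph 1 lam lt δ).Adj u v ↔ u ≠ v ∧ cl u = cl v :=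
  Dataset.graph_adj_iff hcl hgap
    (fun u => norm_ridge_singleton_sub_le h.exciting hlam hlt (hN u) (h.covers_singleton u)) hCI u v

theorem subOpt_le (h : D.IsGood θ cl lam lt δ) (hlam : 0 < lam) (hlt : 0 < lt) {α : ℝ} {u : Fin U}
    (hpool : D.pool α lam lt δ u = trueCluster cl u) {A : Set (Vec d)} {a : Vec d}
    (hA : ∀ b ∈ A, ‖b‖ ≤ 1) (ha : D.IsOffCLUBAction α lam lt δ u A a) :
    subOpt (θ u) A a ≤ 2 * confRadius U d lam δ (sampleCount D.N (trueCluster cl u))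
      / √(lam + lt * sampleCount D.N (trueCluster cl u) / 2) := by
  rw [← hpool]
  exact Dataset.subOpt_le h.exciting hlam hlt (hpool ▸ h.covers_trueCluster u) hA ha

end Dataset.IsGood

end GoodEvent

end OffClusBand

open OffClusBand in
theorem mainTheorem2 {Ω : Type*} [MeasurableSpace Ω] (P : Measure Ω) [IsProbabilityMeasure P]
    (U d J S : ℕ)
    -- preference vectors and their clusters
    (θ : Fin U → Vec d) (hθ : ∀ u, ‖θ u‖ ≤ 1)
    (cl : Fin U → Fin J) (hcl : ∀ u v, θ u = θ v ↔ cl u = cl v)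
    (γ : ℝ) (hγ : 0 < γ) (hgap : ∀ u v, cl u ≠ cl v → γ ≤ ‖θ u - θ v‖)
    -- action regularity and the random dataset
    (ρ : Measure (Vec d)) (lamA σ : ℝ) (hρ : ActionRegular ρ lamA σ)
    (X : OfflineData P θ ρ S)
    (lt : ℝ) (hlt : lt = smoothedReg lamA σ S)
    -- parameters
    (δ : ℝ) (hδ₀ : 0 < δ) (hδ₁ : δ < 1 / 2) (lam : ℝ) (hlam : 0 < lam)
    (hsuff : CompletelySufficient d X.N lt γ δ)
    (hlam_le : ∀ u, lam ≤ d * Real.log (1 + X.N u / (lam * d)) + 2 * Real.log (2 * U / δ))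
    (hδ_le : δ ≤ 2 * U / (1 + gapThreshold U d lt γ δ / (lam * d))) :
    ∃ E : Set Ω, MeasurableSet E ∧ 1 - 2 * δ ≤ P.real E ∧ ∀ ω ∈ E,
      (X.dataset ω).ClustersCorrectly cl 1 lam lt δ ∧
      ∀ (uTest : Fin U) (A : Set (Vec d)) (a : Vec d), (∀ b ∈ A, ‖b‖ ≤ 1) →
        (X.dataset ω).IsOffCLUBAction 1 lam lt δ uTest A a →
          subOpt (θ uTest) A a ≤
            2 * confRadius U d lam δ (sampleCount X.N (trueCluster cl uTest)) /
              √(lam + lt * sampleCount X.N (trueCluster cl uTest) / 2) ∧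
          subOpt (θ uTest) A a ≤
            8 * √(d / (lt * sampleCount X.N (trueCluster cl uTest))) *
              √(Real.log (1 + sampleCount X.N (trueCluster cl uTest) / (lam * d))
                + Real.log (2 * U / δ)) := by
  subst hlt
  have hlt := smoothedReg_pos hρ.lamA_pos hρ.sigma_pos S
  have hd := hρ.dim_pos
  have hcl' (u v : Fin U) : cl u = cl v → θ u = θ v := (hcl u v).2
  have hK (u : Fin U) := log_two_mul_div_pos u.pos hδ₀ (hδ₁.trans (by norm_num))
  have hT (u : Fin U) := gapThreshold_pos hd hlt hγ (hK u)
  have hTN (u : Fin U) := (le_max_right _ _).trans (hsuff u)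
  have hN (u : Fin U) : 0 < X.N u := by exact_mod_cast (hT u).trans_le (hTN u)
  have hCI (u : Fin U) : confRadius U d lam δ (X.N u) / √(smoothedReg lamA σ S * X.N u / 2)
      < γ / 4 :=
    confRadius_div_sqrt_lt hlt hγ (hN u) (hlam_le u) <|
      mul_log_add_log_lt_of_gapThreshold_le hd hlam hlt hγ (hK u) (hTN u) <|
        log_one_add_le_log_div (div_pos (hT u) (by positivity)).le hδ₀ hδ_le
  obtain ⟨E, hE, hPE, hgood⟩ := exists_measurableSet_forall_of_measure_not_le (by positivity) <|
    X.measure_not_isGood_le hρ hθ hcl' hδ₀ hδ₁.le hlam fun u => (le_max_left _ _).trans (hsuff u)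
  refine ⟨E, hE, hPE, fun ω hω => ?_⟩
  have hadj := (hgood ω hω).graph_adj_iff hcl' hgap hlam hlt hN hCI
  refine ⟨Dataset.clustersCorrectly_of_adj_iff hadj, fun u A a hA ha => ?_⟩
  have hsub := (hgood ω hω).subOpt_le hlam hlt (Dataset.pool_eq_trueCluster_of_adj_iff hadj u) hA ha
  have hle := le_sampleCount_trueCluster X.N cl u
  refine ⟨hsub, hsub.trans (two_mul_confRadius_div_le hd hlam hlt ((hN u).trans_le hle) (hK u).le
    ((hlam_le u).trans ?_))⟩
  gcongr
  exact hle
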